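/- Let $\mathcal H$ be the upper half-plane, $q=e^{2\pi i\tau}$, $\theta(\tau)=\sum_{n\in\mathbb Z}q^{n^2}$, and $\eta(\tau)=q^{1/24}\prod_{n\ge1}(1-q^n)$ with $q^{1/24}=e^{\pi i\tau/12}$. For $k\ge0$, $4\mid N$ and a Dirichlet character $\chi$ modulo $N$, let $S_{k+1/2}(N,\chi)$ be Shimura's space of cusp forms of weight $k+\tfrac12$: holomorphic $f:\mathcal H\to\mathbb C$ that vanish at every cusp and satisfy $f(\gamma\tau)=\chi(d)\,\bigl(\theta(\gamma\tau)/\theta(\tau)\bigr)^{2k+1}f(\tau)$ for all $\gamma=\begin{pmatrix}a&b\\c&d\end{pmatrix}\in\Gamma_0(N)$. Vanishing at every cusp means that $(c\tau+d)^{-k-1/2}f(\gamma\tau)\to0$ as $\operatorname{Im}\tau\to\infty$ for every $\gamma\in SL_2(\mathbb Z)$. For a prime $\ell$ the Hecke operator $T(\ell^2)$ in weight $k+\tfrac12$ and character $\chi$ sends $f=\sum_{n\ge0}a(n)q^n$ to $f\mid T(\ell^2)=\sum_{n\ge0}c(n)q^n$, where $$c(n)=a(\ell^2n)+\chi(\ell)\left(\frac{(-1)^kn}{\ell}\right)\ell^{k-1}a(n)+\chi(\ell^2)\,\ell^{2k-1}a(n/\ell^2)$$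 and $a(n/\ell^2)=0$ if $\ell^2\nmid n$. Let $\chi_{12}(n)=1$ if $n\equiv\pm1\pmod{12}$, $\chi_{12}(n)=-1$ if $n\equiv\pm5\pmod{12}$, and $\chi_{12}(n)=0$ otherwise. For an integer $m\ge0$ let $M_m(1)$ be the space of modular forms of weight $m$ on $SL_2(\mathbb Z)$. **Proposition 3.1.** Let $1\le r\le23$ with $(r,6)=1$, let $m$ be an even nonnegative integer, let $\ell>3$ be a prime, and put $k=m+\tfrac{r-1}2$. Define $$\mathcal C_{r,k}:=\{\eta^r(24\tau)F(24\tau):F\in M_m(1)\}.$$ Then $\mathcal C_{r,k}\subset S_{r/2+m}(576,\chi_{12})$, and the Hecke operator $T(\ell^2)$ in weight $k+\tfrac12=\tfrac r2+m$ and character $\chi_{12}$ maps $\mathcal C_{r,k}$ into $\mathcal C_{r,k}$; in particular, for every $g\in\mathcal C_{r,k}$ the series defining $g\mid T(\ell^2)$ converges on $\mathcal H$. -/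

import Mathlib

open UpperHalfPlane hiding I
open scoped MatrixGroups Manifold

noncomputable section

namespace HalfIntegral

/-- The theta function `θ(τ) = ∑_{n ∈ ℤ} exp(2πi n² τ)`. Mathlib's `jacobiTheta τ` is
`∑_{n ∈ ℤ} exp(πi n² τ)`. -/
def theta (τ : ℍ) : ℂ := jacobiTheta (2 * (τ : ℂ))

/-- The transformation law of weight `k + 1/2` and character `χ` on `Γ₀(N)`, for `4 ∣ N`, in the
sense of Shimura: `f(γτ) = χ(d) j(γ, τ)^(2k+1) f(τ)` for `γ = (a b; c d) ∈ Γ₀(N)`, where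
`j(γ, τ) = θ(γτ) / θ(τ)` is the theta automorphy factor. The denominator is cleared; since `θ` has
no zeros on the upper half-plane, nothing is lost. -/
def IsThetaInvariant (k N : ℕ) (χ : DirichletCharacter ℂ N) (f : ℍ → ℂ) : Prop :=
  ∀ γ ∈ CongruenceSubgroup.Gamma0 N, ∀ τ : ℍ,
    theta τ ^ (2 * k + 1) * f (γ • τ) =
      χ ((γ 1 1 : ℤ) : ZMod N) * theta (γ • τ) ^ (2 * k + 1) * f τ

/-- The slash action `f ∣_{k+1/2} ξ = φ(τ)^(-2k-1) f(γτ)` of the pair `ξ = (γ, φ)`, where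
`γ = (a b; c d) ∈ SL₂(ℤ)` and `φ(τ) = (cτ + d)^(1/2)` (principal branch, which is holomorphic on
the upper half-plane). Any other `φ` with `φ(τ)² = s (cτ + d)`, `|s| = 1`, changes the result by a
constant factor of absolute value one. -/
def halfSlash (k : ℕ) (f : ℍ → ℂ) (γ : SL(2, ℤ)) (τ : ℍ) : ℂ :=
  ((((γ 1 0 : ℤ) : ℂ) * (τ : ℂ) + ((γ 1 1 : ℤ) : ℂ)) ^ (1 / 2 : ℂ)) ^ (-(2 * (k : ℤ) + 1)) *
    f (γ • τ)

/-- The space `S_{k+1/2}(N, χ)` (for `4 ∣ N`) of cusp forms of weight `k + 1/2` and character `χ`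
on `Γ₀(N)`: holomorphic functions on the upper half-plane with the transformation law above which
vanish at every cusp. The cusps are the points `γ∞` with `γ ∈ SL₂(ℤ)`. -/
def cuspForms (k N : ℕ) (χ : DirichletCharacter ℂ N) : Submodule ℂ (ℍ → ℂ) where
  carrier := {f | MDifferentiable 𝓘(ℂ) 𝓘(ℂ) f ∧ IsThetaInvariant k N χ f ∧
    ∀ γ : SL(2, ℤ), IsZeroAtImInfty (halfSlash k f γ)}
  add_mem' := by
    rintro f g ⟨hf₁, hf₂, hf₃⟩ ⟨hg₁, hg₂, hg₃⟩
    refine ⟨hf₁.add hg₁, fun γ hγ τ => ?_, fun γ => ?_⟩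
    · have h₁ := hf₂ γ hγ τ
      have h₂ := hg₂ γ hγ τ
      simp only [Pi.add_apply]
      linear_combination h₁ + h₂
    · have h : halfSlash k (f + g) γ = halfSlash k f γ + halfSlash k g γ := by
        funext τ
        simp only [halfSlash, Pi.add_apply, mul_add]
      rw [h]
      exact (hf₃ γ).add (hg₃ γ)
  zero_mem' := by
    refine ⟨mdifferentiable_const, fun γ hγ τ => by simp, fun γ => ?_⟩
    have h : halfSlash k 0 γ = 0 := by
      funext τ
      simp [halfSlash]
    rw [h]
    exact Filter.zero_zeroAtFilter _
  smul_mem' := by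
    rintro c f ⟨hf₁, hf₂, hf₃⟩
    refine ⟨hf₁.const_smul c, fun γ hγ τ => ?_, fun γ => ?_⟩
    · have h₁ := hf₂ γ hγ τ
      simp only [Pi.smul_apply, smul_eq_mul]
      linear_combination c * h₁
    · have h : halfSlash k (c • f) γ = c • halfSlash k f γ := by
        funext τ
        simp only [halfSlash, Pi.smul_apply, smul_eq_mul]
        ring
      rw [h]
      exact (hf₃ γ).smul c

/-- The coefficient `a(n)` of `q^n`, `q = exp(2πiτ)`, in the `q`-expansion of a (1-periodic)
function on the upper half-plane. -/
def qCoeff (f : ℍ → ℂ) (n : ℕ) : ℂ := (qExpansion 1 f).coeff n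

/-- The coefficient
`c(n) = a(ℓ²n) + χ(ℓ) ((-1)^k n / ℓ) ℓ^(k-1) a(n) + χ(ℓ²) ℓ^(2k-1) a(n/ℓ²)`
of `q^n` in `f ∣ T(ℓ²)`, for `f = ∑ a(n) q^n` of weight `k + 1/2` and character `χ`; here
`a(n/ℓ²) = 0` if `ℓ² ∤ n`. The exponents `k - 1` and `2k - 1` are integers, equal to `-1` if
`k = 0`. -/
def heckeCoeff (k : ℕ) {N : ℕ} (χ : DirichletCharacter ℂ N) (ℓ : ℕ) [Fact ℓ.Prime]
    (f : ℍ → ℂ) (n : ℕ) : ℂ :=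
  qCoeff f (ℓ ^ 2 * n) +
    χ (ℓ : ZMod N) * (legendreSym ℓ ((-1) ^ k * (n : ℤ)) : ℂ) * (ℓ : ℂ) ^ ((k : ℤ) - 1) *
      qCoeff f n +
    χ ((ℓ ^ 2 : ℕ) : ZMod N) * (ℓ : ℂ) ^ (2 * (k : ℤ) - 1) *
      (if ℓ ^ 2 ∣ n then qCoeff f (n / ℓ ^ 2) else 0)

/-- The Hecke operator `T(ℓ²)` in weight `k + 1/2` and character `χ`:
`f ∣ T(ℓ²) = ∑ c(n) q^n` with `q = exp(2πiτ)`. -/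
def hecke (k : ℕ) {N : ℕ} (χ : DirichletCharacter ℂ N) (ℓ : ℕ) [Fact ℓ.Prime]
    (f : ℍ → ℂ) (τ : ℍ) : ℂ :=
  ∑' n : ℕ, heckeCoeff k χ ℓ f n * Complex.exp (2 * Real.pi * Complex.I * (τ : ℂ)) ^ n

/-- The character modulo `12` with `χ₁₂(n) = 1` if `n ≡ ±1`, `χ₁₂(n) = -1` if `n ≡ ±5`, and
`χ₁₂(n) = 0` otherwise, with integer values. -/
def chi12Int : MulChar (ZMod 12) ℤ where
  toFun a := if a = 1 ∨ a = -1 then 1 else if a = 5 ∨ a = -5 then -1 else 0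
  map_one' := by decide
  map_mul' := by decide
  map_nonunit' := by decide

/-- The character `χ₁₂`, viewed as a Dirichlet character modulo `576`. -/
def chi12 : DirichletCharacter ℂ 576 :=
  DirichletCharacter.changeLevel (show 12 ∣ 576 by norm_num)
    (chi12Int.ringHomComp (Int.castRingHom ℂ))

/-- The point `24τ` of the upper half-plane. -/
def mul24 (τ : ℍ) : ℍ := ⟨24 * (τ : ℂ), by simpa using τ.im_pos⟩

/-- The space of functions `τ ↦ η(24τ)^r F(24τ)` with `F ∈ M_m(1)`, the modular forms of weight
`m` on `SL₂(ℤ)`. -/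
def etaSpace (r m : ℕ) : Submodule ℂ (ℍ → ℂ) where
  carrier := {g | ∃ F : ModularForm 𝒮ℒ (m : ℤ),
    ∀ τ : ℍ, g τ = ModularForm.eta (mul24 τ : ℂ) ^ r * F (mul24 τ)}
  add_mem' := by
    rintro f g ⟨F, hF⟩ ⟨G, hG⟩
    refine ⟨F + G, fun τ => ?_⟩
    simp only [Pi.add_apply, hF, hG, add_apply]
    ring
  zero_mem' := ⟨0, fun τ => by simp⟩
  smul_mem' := by
    rintro c f ⟨F, hF⟩
    refine ⟨c • F, fun τ => ?_⟩
    simp only [Pi.smul_apply, hF, smul_apply, smul_eq_mul]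
    ring

end HalfIntegral

end

/-! Everything rests on writing `η` through the two-variable theta function Θ(z, t) = `jacobiTheta₂
z t`. The pentagonal number theorem gives η(w) = ½ ∑ χ₁₂(N) exp(πi N² w / 12), and inversion turns
this into √12 η(w) = Θ(1/12, w/12) - Θ(5/12, w/12).

Cusp forms. Both θ(τ) = Θ(0, 2τ) and √12 η(24τ) = Θ(1/12, 2τ) - Θ(5/12, 2τ) are made of values of
one function Θ(·, 2τ) at 12-torsion points. In the modular transformation law of Θ the constant κ
does not depend on z, and for Γ₀(576) the torsion point j/12 goes to dj/12. So θ(τ) and η(24τ)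
acquire the same factor κ up to χ₁₂(d) (`exists_theta_factor`), and the theta multiplier never has
to be evaluated. Since κ⁴ = (cτ + d)² and m is even, the factor of F is a power of κ too. Vanishing
at the cusps is checked on 24th powers: (η^r F)²⁴ = Δ^r F²⁴ has level one and integral weight.

Hecke operator. Put h = η^r F and w = 24τ. The image under T(ℓ²) is a combination `heckeSum` of h((w
+ 24b)/ℓ²), of the Legendre twist of h(w + 24u/ℓ), and of h(ℓ²w). It suffices that its quotient by
η^r is a modular form of weight m for SL₂(ℤ), which is tested on T, on S and at infinity.

For T: the exponents of h are congruent to r modulo 24, and T(ℓ²) preserves this because ℓ² ≡ 1 (mod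
24).

For S (`EtaTransforms.heckeSum_neg_inv`): w ↦ -1/w exchanges the term b = 0 with h(ℓ²w), exchanges
the nonzero b divisible by ℓ with the Legendre twist, and permutes the terms with b a unit. All
matrices involved have the shape (24A B; c 24D), for which the multiplier of η is χ₁₂(c) times a
normalised quadratic Gauss sum (`eta_gaussSum`). Modulo ℓ the odd power r of that sum produces the
Legendre symbol; modulo ℓ² the normalised sum is 1. The coefficients of T(ℓ²) are exactly those that
make the exchanged terms match.

At infinity: exponents that are nonnegative and congruent to r ≤ 23 modulo 24 are at least r, so
division by η^r leaves a bounded function. -/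

namespace HalfIntegral

open Complex Filter Topology

/-! ### The pentagonal number theorem for complex `x` in the unit disc -/

section Pentagonal

variable {x : ℂ}

lemma norm_prod_one_sub_pow_le (hx : ‖x‖ < 1) (k n : ℕ) :
    ‖∏ i ∈ Finset.range n, (1 - x ^ (k + i + 1))‖ ≤ Real.exp (1 - ‖x‖)⁻¹ := by
  have h0 := norm_nonneg x
  calc ‖∏ i ∈ Finset.range n, (1 - x ^ (k + i + 1))‖
      = ∏ i ∈ Finset.range n, ‖1 - x ^ (k + i + 1)‖ := norm_prod _ _
    _ ≤ ∏ i ∈ Finset.range n, (1 + ‖x‖ ^ i) := by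
        refine Finset.prod_le_prod (fun _ _ => norm_nonneg _) fun i _ => ?_
        refine (norm_sub_le _ _).trans ?_
        rw [norm_one, norm_pow]
        have := pow_le_pow_of_le_one h0 hx.le (show i ≤ k + i + 1 by omega)
        linarith
    _ ≤ Real.exp (∑ i ∈ Finset.range n, ‖x‖ ^ i) :=
        Real.prod_one_add_le_exp_sum _ fun i => pow_nonneg h0 i
    _ ≤ Real.exp (1 - ‖x‖)⁻¹ := by
        rw [Real.exp_le_exp, ← tsum_geometric_of_lt_one h0 hx]
        exact (summable_geometric_of_lt_one h0 hx).sum_le_tsum _ fun i _ => pow_nonneg h0 i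

/-- The bound is uniform in `k`, so it serves twice: for summability of the inner series, and for
the vanishing of the remainder as `k` grows. -/
lemma norm_pow_mul_prod_one_sub_pow_le (hx : ‖x‖ < 1) (k n : ℕ) :
    ‖x ^ ((k + 1) * n) * ∏ i ∈ Finset.range (n + 1), (1 - x ^ (k + i + 1))‖ ≤
      ‖x‖ ^ n * Real.exp (1 - ‖x‖)⁻¹ := by
  rw [norm_mul, norm_pow]
  gcongr ?_ * ?_
  · exact pow_le_pow_of_le_one (norm_nonneg x) hx.le (by nlinarith [Nat.zero_le (k * n)])
  · exact norm_prod_one_sub_pow_le hx k (n + 1)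

lemma norm_le_pow_of_le_pentagonal (hx : ‖x‖ < 1) (k : ℕ) :
    ‖(-1) ^ k * (x ^ pentagonal (-k) - x ^ pentagonal (k + 1))‖ ≤ 2 * ‖x‖ ^ k := by
  have h (j : ℤ) (hj : (k : ℤ) ≤ pentagonal j) : ‖x‖ ^ pentagonal j ≤ ‖x‖ ^ k :=
    pow_le_pow_of_le_one (norm_nonneg x) hx.le (by exact_mod_cast hj)
  have h₁ := h (-k) (by nlinarith [two_mul_natCast_pentagonal_neg k])
  have h₂ := h (k + 1) (by nlinarith [two_mul_natCast_pentagonal (k + 1)])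
  rw [norm_mul, norm_pow, norm_neg, norm_one, one_pow, one_mul]
  refine (norm_sub_le _ _).trans ?_
  rw [norm_pow, norm_pow]
  linarith

lemma summable_pow_pentagonal (hx : ‖x‖ < 1) :
    Summable fun k : ℕ => (-1) ^ k * (x ^ pentagonal (-k) - x ^ pentagonal (k + 1)) :=
  .of_norm_bounded ((summable_geometric_of_lt_one (norm_nonneg x) hx).mul_left 2)
    (norm_le_pow_of_le_pentagonal hx)

/-- The pentagonal number theorem for complex numbers. -/
theorem hasSum_pow_pentagonal (hx : ‖x‖ < 1) :
    HasSum (fun k : ℕ => (-1) ^ k * (x ^ pentagonal (-k) - x ^ pentagonal (k + 1)))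
      (∏' n, (1 - x ^ (n + 1))) := by
  have hgeo := summable_geometric_of_lt_one (norm_nonneg x) hx
  have hb (k : ℕ) := norm_pow_mul_prod_one_sub_pow_le hx k
  have hmul (k : ℕ) : Multipliable fun n => 1 - x ^ (n + k + 1) := by
    simp_rw [sub_eq_add_neg]
    refine multipliable_one_add_of_summable ?_
    refine Summable.of_nonneg_of_le (fun _ => norm_nonneg _) (fun n => ?_) hgeo
    rw [norm_neg, norm_pow]
    exact pow_le_pow_of_le_one (norm_nonneg x) hx.le (by omega)
  rw [Pentagonal.tprod_one_sub_pow (tendsto_pow_atTop_nhds_zero_of_norm_lt_one hx)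
    (fun k => .of_norm_bounded (hgeo.mul_right _) (hb k)) hmul
    (summable_pow_pentagonal hx) ?_]
  · exact (summable_pow_pentagonal hx).hasSum
  · refine squeeze_zero_norm (a := fun k : ℕ => ‖x‖ ^ k *
      ∑' n : ℕ, ‖x‖ ^ n * Real.exp (1 - ‖x‖)⁻¹) (fun k => ?_) ?_
    · rw [norm_mul, norm_mul, norm_pow, norm_neg, norm_one, one_pow, one_mul, norm_pow]
      gcongr ?_ * ?_
      · refine pow_le_pow_of_le_one (norm_nonneg x) hx.le ?_
        rw [Nat.le_div_iff_mul_le (by norm_num)]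
        nlinarith [Nat.zero_le (k * k)]
      · exact tsum_of_norm_bounded (hgeo.mul_right _).hasSum (hb k)
    · simpa using (tendsto_pow_atTop_nhds_zero_of_lt_one (norm_nonneg x) hx).mul_const _

end Pentagonal

/-! ### The eta function as a theta series -/

section Theta

/-- The two-variable theta function as a sum over the residue classes modulo `c`. -/
lemma hasSum_jacobiTheta₂_residues (c : ℕ) [NeZero c] (z : ℂ) {τ : ℂ} (hτ : 0 < τ.im) :
    HasSum (fun p : ℤ × Fin c => cexp (2 * Real.pi * I * (p.2 : ℕ) * z +
        Real.pi * I * (p.2 : ℕ) ^ 2 * τ) *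
        jacobiTheta₂_term p.1 (c * z + c * (p.2 : ℕ) * τ) (c ^ 2 * τ)) (jacobiTheta₂ z τ) := by
  have h := (Int.divModEquiv c).symm.hasSum_iff.mpr (hasSum_jacobiTheta₂_term z hτ)
  refine h.congr_fun fun p => ?_
  simp only [Function.comp_apply, jacobiTheta₂_term, Int.divModEquiv_symm_apply, ← Complex.exp_add]
  push_cast
  ring_nf

lemma im_natCast_sq_mul_pos (c : ℕ) [NeZero c] {τ : ℂ} (hτ : 0 < τ.im) :
    0 < ((c : ℂ) ^ 2 * τ).im := by
  have h : ((c : ℂ) ^ 2 * τ).im = (c : ℝ) ^ 2 * τ.im := by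
    rw [← Complex.im_ofReal_mul]
    push_cast
    rfl
  rw [h]
  have : (0 : ℝ) < c := by exact_mod_cast NeZero.pos c
  positivity

lemma jacobiTheta₂_eq_sum_residues (c : ℕ) [NeZero c] (z : ℂ) {τ : ℂ} (hτ : 0 < τ.im) :
    jacobiTheta₂ z τ = ∑ j : Fin c, cexp (2 * Real.pi * I * (j : ℕ) * z +
        Real.pi * I * (j : ℕ) ^ 2 * τ) * jacobiTheta₂ (c * z + c * (j : ℕ) * τ) (c ^ 2 * τ) := by
  have h := (Equiv.prodComm _ _).hasSum_iff.mpr (hasSum_jacobiTheta₂_residues c z hτ)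
  refine (h.prod_fiberwise fun j => ?_).unique (hasSum_fintype _)
  exact (hasSum_jacobiTheta₂_term _ (im_natCast_sq_mul_pos c hτ)).mul_left _

/-- The theta series `∑_{N ≡ i mod 12} exp(πi N² w / 12)`. -/
noncomputable def thetaSeries12 (i : ℤ) (w : ℂ) : ℂ :=
  cexp (Real.pi * I * i ^ 2 * w / 12) * jacobiTheta₂ (i * w) (12 * w)

lemma thetaSeries12_neg (i : ℤ) (w : ℂ) : thetaSeries12 (-i) w = thetaSeries12 i w := by
  simp [thetaSeries12]

lemma thetaSeries12_add (i : ℤ) (w : ℂ) : thetaSeries12 (i + 12) w = thetaSeries12 i w := by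
  have h := jacobiTheta₂_add_left' (i * w) (12 * w)
  rw [thetaSeries12, thetaSeries12, show ((i + 12 : ℤ) : ℂ) * w = i * w + 12 * w by push_cast; ring,
    h, ← mul_assoc, ← Complex.exp_add]
  push_cast
  congr 2
  ring

lemma thetaSeries12_congr {i j : ℤ} (h : i ≡ j [ZMOD 12]) (w : ℂ) :
    thetaSeries12 i w = thetaSeries12 j w := by
  have hp : Function.Periodic (thetaSeries12 · w) 12 := fun i => thetaSeries12_add i w
  obtain ⟨n, hn⟩ := h.dvd
  have : thetaSeries12 (i + n * 12) w = thetaSeries12 i w := hp.int_mul n i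
  rw [← this, show i + n * 12 = j by linarith]

/-- This is the pentagonal number theorem: in the theta series the indices `k` and `-(k + 1)` give
the two generalized pentagonal exponents, with opposite signs. -/
lemma eta_eq_jacobiTheta₂ {w : ℂ} (hw : 0 < w.im) :
    ModularForm.eta w =
      cexp (Real.pi * I * w / 12) * jacobiTheta₂ ((1 + w) / 2) (3 * w) := by
  have hw3 : 0 < (3 * w).im := by simpa using hw
  have hq : ‖cexp (2 * Real.pi * I * w)‖ < 1 := norm_exp_two_pi_I_lt_one ⟨w, hw⟩
  have h := (hasSum_pow_pentagonal hq).mul_left (cexp (Real.pi * I * w / 12))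
  have h' := (((hasSum_jacobiTheta₂_term ((1 + w) / 2) hw3).mul_left
    (cexp (Real.pi * I * w / 12)))).nat_add_neg_add_one
  have heta : ModularForm.eta w = cexp (Real.pi * I * w / 12) *
      ∏' n : ℕ, (1 - cexp (2 * Real.pi * I * w) ^ (n + 1)) := by
    simp only [ModularForm.eta, ModularForm.eta_q_eq_pow]
    congr 1
    simp only [Function.Periodic.qParam]
    push_cast
    congr 1
    ring
  rw [heta]
  refine h.unique (h'.congr_fun fun k => ?_)
  have hone : ((-1 : ℂ)) ^ k = cexp (Real.pi * I * k) := by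
    rw [← Complex.exp_pi_mul_I, ← Complex.exp_nat_mul]
    ring_nf
  have e1 : ((pentagonal (-k) : ℕ) : ℂ) = k * (3 * k + 1) / 2 := by
    have := two_mul_natCast_pentagonal_neg k
    have : (2 : ℂ) * (pentagonal (-k) : ℕ) = k * (3 * k + 1) := by exact_mod_cast this
    linear_combination this / 2
  have e2 : ((pentagonal (k + 1) : ℕ) : ℂ) = (k + 1) * (3 * k + 2) / 2 := by
    have := two_mul_natCast_pentagonal (k + 1)
    have : (2 : ℂ) * (pentagonal (k + 1) : ℕ) = (k + 1) * (3 * (k + 1) - 1) := by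
      exact_mod_cast this
    linear_combination this / 2
  have hneg : ∀ y : ℂ, cexp (2 * Real.pi * I * (-(k + 1)) * (1 / 2) + y) =
      - cexp (Real.pi * I * k + y) := by
    intro y
    rw [show 2 * Real.pi * I * (-(k + 1)) * (1 / 2) + y = (Real.pi * I * k + y + Real.pi * I)
      + ((-(k + 1) : ℤ) : ℂ) * (2 * Real.pi * I) by push_cast; ring,
      Complex.exp_add, Complex.exp_int_mul_two_pi_mul_I, mul_one, Complex.exp_add_pi_mul_I]
  rw [hone, mul_sub, mul_sub, ← Complex.exp_nat_mul, ← Complex.exp_nat_mul, ← Complex.exp_add,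
    ← Complex.exp_add, ← Complex.exp_add, ← Complex.exp_add, e1, e2, jacobiTheta₂_term,
    jacobiTheta₂_term, ← Complex.exp_add, ← Complex.exp_add, sub_eq_add_neg]
  congr 1
  · congr 1
    push_cast
    ring
  · rw [show Real.pi * I * w / 12 + (2 * Real.pi * I * ((-((k : ℤ) + 1) : ℤ) : ℂ) * ((1 + w) / 2) +
      Real.pi * I * ((-((k : ℤ) + 1) : ℤ) : ℂ) ^ 2 * (3 * w)) =
      2 * Real.pi * I * (-(k + 1)) * (1 / 2) + (Real.pi * I * w / 12 +
        Real.pi * I * (k + 1) * (3 * k + 2) * w) by push_cast; ring, hneg]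
    congr 2
    ring

/-- `η(w) = ½ ∑_N χ₁₂(N) exp(πi N² w / 12)`. -/
lemma eta_eq_thetaSeries12 {w : ℂ} (hw : 0 < w.im) :
    ModularForm.eta w = thetaSeries12 1 w - thetaSeries12 5 w := by
  have hw3 : 0 < (3 * w).im := by simpa using hw
  -- Splitting the summation index n of `6n + 1` by parity gives the classes 1 and 7 modulo 12, and
  -- 7 ≡ -5.
  have h7 : thetaSeries12 5 w = thetaSeries12 7 w := by
    rw [← thetaSeries12_neg 7]
    exact thetaSeries12_congr (by decide) w
  rw [eta_eq_jacobiTheta₂ hw, jacobiTheta₂_eq_sum_residues 2 _ hw3, Fin.sum_univ_two, mul_add, h7,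
    sub_eq_add_neg, thetaSeries12, thetaSeries12]
  congr 1
  · rw [← mul_assoc, ← Complex.exp_add, ← jacobiTheta₂_add_left (((1 : ℤ) : ℂ) * w)]
    simp only [Fin.val_zero]
    push_cast
    congr 2 <;> ring
  · rw [← mul_assoc, ← Complex.exp_add, ← neg_mul, ← Complex.exp_add_pi_mul_I,
      ← jacobiTheta₂_add_left (((7 : ℤ) : ℂ) * w)]
    simp only [Fin.val_one]
    push_cast
    congr 2 <;> ring_nf

end Theta

end HalfIntegral

namespace HalfIntegral

open Complex Filter Topology

/-! ### The branch of the square root, and inversion of eta -/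

section SqrtNegI

/-- The holomorphic square root `√(-i w)` on the upper half-plane. -/
noncomputable def sqrtNegI (w : ℂ) : ℂ := (-I * w) ^ (1 / 2 : ℂ)

lemma sqrtNegI_sq (w : ℂ) : sqrtNegI w ^ 2 = -I * w := by
  rw [sqrtNegI, ← Complex.cpow_nat_mul]
  simp

lemma sqrtNegI_pow_four (w : ℂ) : sqrtNegI w ^ 4 = -w ^ 2 := by
  rw [show 4 = 2 * 2 from rfl, pow_mul, sqrtNegI_sq, mul_pow, neg_sq, I_sq]
  ring

lemma sqrtNegI_ne_zero {w : ℂ} (hw : w ≠ 0) : sqrtNegI w ≠ 0 := by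
  intro h
  have := sqrtNegI_sq w
  rw [h] at this
  simp_all

lemma sqrtNegI_ofReal_mul {a : ℝ} (ha : 0 < a) {w : ℂ} (hw : w ≠ 0) :
    sqrtNegI (a * w) = (√a : ℝ) * sqrtNegI w := by
  have hI : -I * w ≠ 0 := by simp [hw]
  rw [sqrtNegI, sqrtNegI, show -I * (a * w) = a * (-I * w) by ring,
    Complex.cpow_def_of_ne_zero (by simp [ha.ne', hw]), Complex.cpow_def_of_ne_zero hI,
    Complex.log_ofReal_mul ha hI, add_mul, Complex.exp_add, Real.sqrt_eq_rpow,
    Real.rpow_def_of_pos ha]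
  push_cast
  rfl

lemma eta_neg_inv {w : ℂ} (hw : 0 < w.im) :
    ModularForm.eta (-1 / w) = sqrtNegI w * ModularForm.eta w := by
  have hw0 : w ≠ 0 := by rintro rfl; simp at hw
  have h : ModularForm.eta (-1 / w) = (Complex.sqrt I)⁻¹ * (Complex.sqrt w * ModularForm.eta w) :=
    ModularForm.eta_comp_eq_csqrt_I_inv hw
  -- The principal logarithm of `-I * w` splits only because the two arguments add up within the
  -- principal range.
  have harg : (-I).arg + w.arg ∈ Set.Ioc (-Real.pi) Real.pi := by
    rw [arg_neg_I]
    have := arg_nonneg_iff.mpr hw.le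
    have := arg_le_pi w
    constructor <;> linarith [Real.pi_pos]
  rw [h, ← mul_assoc]
  congr 1
  rw [sqrtNegI, Complex.sqrt, Complex.sqrt, Complex.cpow_def_of_ne_zero I_ne_zero,
    Complex.cpow_def_of_ne_zero hw0, Complex.cpow_def_of_ne_zero (by simp [hw0]),
    Complex.log_mul (by simp) hw0 harg, ← Complex.exp_neg, ← Complex.exp_add, log_I, log_neg_I]
  congr 1
  ring

end SqrtNegI

/-! ### Eta from 12-torsion values of theta; translations of theta -/

section ThetaEta

lemma jacobiTheta₂_neg_inv {z t : ℂ} (ht : t ≠ 0) :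
    jacobiTheta₂ (z / t) (-1 / t) =
      sqrtNegI t * cexp (Real.pi * I * z ^ 2 / t) * jacobiTheta₂ z t := by
  rw [jacobiTheta₂_functional_equation z t, ← sqrtNegI]
  have h := sqrtNegI_ne_zero ht
  have e : cexp (Real.pi * I * z ^ 2 / t) * cexp (-Real.pi * I * z ^ 2 / t) = 1 := by
    rw [← Complex.exp_add]
    ring_nf
    exact Complex.exp_zero
  rw [one_div, show sqrtNegI t * cexp (Real.pi * I * z ^ 2 / t) * ((sqrtNegI t)⁻¹ *
    cexp (-Real.pi * I * z ^ 2 / t) * jacobiTheta₂ (z / t) (-1 / t)) =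
    (sqrtNegI t * (sqrtNegI t)⁻¹) * (cexp (Real.pi * I * z ^ 2 / t) *
      cexp (-Real.pi * I * z ^ 2 / t)) * jacobiTheta₂ (z / t) (-1 / t) by ring, e,
    mul_inv_cancel₀ h, one_mul, one_mul]

lemma im_neg_inv_pos {w : ℂ} (hw : 0 < w.im) : 0 < (-1 / w).im := by
  have := UpperHalfPlane.im_inv_neg_coe_pos ⟨w, hw⟩
  rwa [show -1 / w = (-w)⁻¹ by rw [inv_neg, neg_div, one_div]]

/-- The functional equation exchanges a theta series over a residue class with a theta value at a
torsion point; the exponential factor it creates is the prefactor in `thetaSeries12`. -/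
lemma thetaSeries12_neg_inv (j : ℤ) {w : ℂ} (hw : 0 < w.im) :
    jacobiTheta₂ (j / 12) (-1 / w / 12) = √12 * sqrtNegI w * thetaSeries12 j w := by
  have hw0 : w ≠ 0 := by rintro rfl; simp at hw
  have h := jacobiTheta₂_neg_inv (z := j * w) (t := 12 * w) (by simp [hw0])
  have h12 := sqrtNegI_ofReal_mul (a := 12) (by norm_num) hw0
  push_cast at h12
  rw [show (j : ℂ) / 12 = j * w / (12 * w) by field_simp, show -1 / w / 12 = -1 / (12 * w) by
    field_simp, h, h12, thetaSeries12, show Real.pi * I * (j * w) ^ 2 / (12 * w) =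
      Real.pi * I * j ^ 2 * w / 12 by field_simp]
  ring

/-- `√12 η(w) = Θ(1/12, w/12) - Θ(5/12, w/12)`. -/
lemma sqrt_mul_eta_eq {w : ℂ} (hw : 0 < w.im) :
    √12 * ModularForm.eta w =
      jacobiTheta₂ (1 / 12) (w / 12) - jacobiTheta₂ (5 / 12) (w / 12) := by
  have hw0 : w ≠ 0 := by rintro rfl; simp at hw
  have hv := im_neg_inv_pos hw
  have h1 := thetaSeries12_neg_inv 1 hv
  have h5 := thetaSeries12_neg_inv 5 hv
  have h := eta_neg_inv hv
  rw [show -1 / (-1 / w) = w by field_simp] at h h1 h5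
  push_cast at h1 h5
  rw [h, h1, h5, eta_eq_thetaSeries12 hv]
  ring

lemma jacobiTheta₂_add_int (z t : ℂ) (n : ℤ) : jacobiTheta₂ (z + n) t = jacobiTheta₂ z t := by
  have hp : Function.Periodic (jacobiTheta₂ · t) 1 := fun z => jacobiTheta₂_add_left z t
  simpa using hp.int_mul n z

lemma jacobiTheta₂_add_int_mul (z t : ℂ) (n : ℤ) :
    jacobiTheta₂ (z + n * t) t =
      cexp (-Real.pi * I * (n ^ 2 * t + 2 * n * z)) * jacobiTheta₂ z t := by
  induction n with
  | zero => simp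
  | succ n ih =>
    rw [show z + ((n + 1 : ℤ) : ℂ) * t = (z + ((n : ℤ) : ℂ) * t) + t by push_cast; ring,
      jacobiTheta₂_add_left', ih, ← mul_assoc, ← Complex.exp_add]
    push_cast
    ring_nf
  | pred n ih =>
    have h := jacobiTheta₂_add_left' (z + ((-(n : ℤ) - 1 : ℤ) : ℂ) * t) t
    rw [show z + ((-(n : ℤ) - 1 : ℤ) : ℂ) * t + t = z + ((-(n : ℤ) : ℤ) : ℂ) * t by
      push_cast; ring, ih] at h
    have h2 : cexp (-Real.pi * I * (((-(n : ℤ) - 1 : ℤ) : ℂ) ^ 2 * t +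
        2 * ((-(n : ℤ) - 1 : ℤ) : ℂ) * z)) = cexp (Real.pi * I * (t +
        2 * (z + ((-(n : ℤ) - 1 : ℤ) : ℂ) * t))) * cexp (-Real.pi * I *
        (((-(n : ℤ) : ℤ) : ℂ) ^ 2 * t + 2 * ((-(n : ℤ) : ℤ) : ℂ) * z)) := by
      rw [← Complex.exp_add]
      push_cast
      ring_nf
    rw [h2, mul_assoc, h, ← mul_assoc, ← Complex.exp_add]
    ring_nf
    simp

/-- The sign exp(πi n²) equals exp(πi n), because n² and n have the same parity. -/
lemma jacobiTheta₂_add_one_right (z t : ℂ) :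
    jacobiTheta₂ z (t + 1) = jacobiTheta₂ (z + 1 / 2) t := by
  refine tsum_congr fun n => ?_
  obtain ⟨j, hj⟩ : Even (n * (n - 1)) := Int.even_mul_pred_self n
  have hj' : (n : ℂ) * (n - 1) = j + j := by exact_mod_cast hj
  rw [jacobiTheta₂_term, jacobiTheta₂_term, show 2 * Real.pi * I * n * z +
    Real.pi * I * n ^ 2 * (t + 1) = 2 * Real.pi * I * n * (z + 1 / 2) + Real.pi * I * n ^ 2 * t
      + j * (2 * Real.pi * I) by linear_combination Real.pi * I * hj',
    Complex.exp_add _ (j * (2 * Real.pi * I)), Complex.exp_int_mul_two_pi_mul_I, mul_one]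

lemma jacobiTheta₂_sub_one_right (z t : ℂ) :
    jacobiTheta₂ z (t - 1) = jacobiTheta₂ (z + 1 / 2) t := by
  rw [← jacobiTheta₂_add_right, show t - 1 + 2 = t + 1 by ring, jacobiTheta₂_add_one_right]

end ThetaEta

/-! ### Transformation of the two-variable theta function under SL₂(ℤ) -/

section Inversion

variable {a b c d : ℤ} {t : ℂ}

lemma intCast_mul_add_ne_zero (h : a * d - b * c = 1) (ht : 0 < t.im) : (c : ℂ) * t + d ≠ 0 := by
  intro h0
  have him := congrArg Complex.im h0
  have hre := congrArg Complex.re h0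
  simp at him hre
  rcases him with hc | hc
  · rw [hc] at hre h
    simp at hre
    rw [hre] at h
    simp at h
  · exact ht.ne' hc

/-- The transformation law of `Θ(z, t)` under the matrix `(a b; c d)` of determinant one. -/
def ThetaTransforms (a b c d : ℤ) : Prop :=
  ∀ t : ℂ, 0 < t.im → ∃ κ : ℂ,
    κ ^ 4 = (-1) ^ (b * c) * (c * t + d) ^ 2 * cexp (Real.pi * I * (a * c) ^ 2 * t) ∧
    ∀ z : ℂ, jacobiTheta₂ (z / (c * t + d)) ((a * t + b) / (c * t + d)) =
      κ * cexp (Real.pi * I * (c * z ^ 2 / (c * t + d) + a * c * z)) *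
        jacobiTheta₂ (z + (a * c * t + b * d) / 2) t

lemma exp_pi_mul_I_mul_int (n : ℤ) : cexp (Real.pi * I * n) = (-1) ^ n := by
  rw [mul_comm, Complex.exp_int_mul, Complex.exp_pi_mul_I]

lemma neg_one_zpow_congr {m n : ℤ} (h : Even (m - n)) : ((-1 : ℂ)) ^ m = (-1) ^ n := by
  rw [show m = (m - n) + n by ring, zpow_add₀ (by norm_num), h.neg_one_zpow, one_mul]

lemma even_sq_sub_self (n : ℤ) : Even (n ^ 2 - n) := by
  have := Int.even_mul_pred_self n
  rwa [show n ^ 2 - n = n * (n - 1) by ring]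

/-- Replacing `t` by `t + 1` shifts `z` by 1/2. The determinant condition shows that the new
half-characteristic differs from the prescribed one by an integer, which theta ignores. -/
lemma ThetaTransforms.mul_T (h : ThetaTransforms a b c d) (hdet : a * d - b * c = 1) :
    ThetaTransforms a (b + a) c (d + c) := by
  intro t ht
  obtain ⟨κ, h4, hz⟩ := h (t + 1) (by simpa using ht)
  refine ⟨κ, ?_, fun z => ?_⟩
  · rw [h4, show Real.pi * I * (a * c) ^ 2 * (t + 1) = Real.pi * I * (a * c) ^ 2 * t +
      Real.pi * I * (((a * c) ^ 2 : ℤ) : ℂ) by push_cast; ring, Complex.exp_add,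
      exp_pi_mul_I_mul_int, neg_one_zpow_congr (even_sq_sub_self (a * c)), add_mul b a c,
      zpow_add₀ (by norm_num)]
    push_cast
    ring
  · have hz := hz z
    rw [jacobiTheta₂_add_one_right] at hz
    have e : (c : ℂ) * t + ((d + c : ℤ) : ℂ) = c * (t + 1) + d := by push_cast; ring
    have e' : (a : ℂ) * t + ((b + a : ℤ) : ℂ) = a * (t + 1) + b := by push_cast; ring
    have hdet' : (a : ℂ) * d - b * c = 1 := by exact_mod_cast hdet
    rw [e, e', hz, ← jacobiTheta₂_add_int _ _ (b * c)]
    congr 2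
    push_cast
    linear_combination (-1 / 2 : ℂ) * hdet'

lemma ThetaTransforms.mul_T_inv (h : ThetaTransforms a b c d) (hdet : a * d - b * c = 1) :
    ThetaTransforms a (b - a) c (d - c) := by
  intro t ht
  obtain ⟨κ, h4, hz⟩ := h (t - 1) (by simpa using ht)
  refine ⟨κ, ?_, fun z => ?_⟩
  · rw [h4, show Real.pi * I * (a * c) ^ 2 * (t - 1) = Real.pi * I * (a * c) ^ 2 * t +
      Real.pi * I * ((-(a * c) ^ 2 : ℤ) : ℂ) by push_cast; ring, Complex.exp_add,
      exp_pi_mul_I_mul_int, neg_one_zpow_congr (m := -(a * c) ^ 2) (n := -(a * c))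
        (by simpa [neg_add_eq_sub] using (even_sq_sub_self (a * c)).neg), sub_mul b a c,
      sub_eq_add_neg (b * c), zpow_add₀ (by norm_num)]
    push_cast
    ring
  · have hz := hz z
    rw [jacobiTheta₂_sub_one_right] at hz
    have e : (c : ℂ) * t + ((d - c : ℤ) : ℂ) = c * (t - 1) + d := by push_cast; ring
    have e' : (a : ℂ) * t + ((b - a : ℤ) : ℂ) = a * (t - 1) + b := by push_cast; ring
    have hdet' : (a : ℂ) * d - b * c = 1 := by exact_mod_cast hdet
    rw [e, e', hz, ← jacobiTheta₂_add_int _ _ (a * c - 1 - b * c)]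
    congr 2
    push_cast
    linear_combination (1 / 2 : ℂ) * hdet'

/-- The known law is applied at `-1/t`, followed by the functional equation at the shifted point. -/
lemma ThetaTransforms.mul_S (h : ThetaTransforms a b c d) (hdet : a * d - b * c = 1) :
    ThetaTransforms b (-a) d (-c) := by
  intro t ht
  have ht0 : t ≠ 0 := by rintro rfl; simp at ht
  have hj : (d : ℂ) * t - c ≠ 0 := by
    have := intCast_mul_add_ne_zero (a := b) (b := -a) (c := d) (d := -c)
      (by linarith) ht
    push_cast at this
    rwa [← sub_eq_add_neg] at this
  obtain ⟨κ, h4, hz⟩ := h (-1 / t) (im_neg_inv_pos ht)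
  have ej : (c : ℂ) * (-1 / t) + d = (d * t - c) / t := by field_simp; ring
  -- Besides the square root, `κ` takes up the part independent of `z` of the exponential of the
  -- shifted argument's square over `t`.
  refine ⟨κ * sqrtNegI t * cexp (Real.pi * I * (b * d * t - a * c) ^ 2 / 4 / t), ?_, fun z => ?_⟩
  · have hdet' : (a : ℂ) * d - b * c = 1 := by exact_mod_cast hdet
    have e1 : cexp (Real.pi * I * (b * d * t - a * c) ^ 2 / 4 / t) ^ 4 *
        cexp (Real.pi * I * (a * c) ^ 2 * (-1 / t)) =
        cexp (Real.pi * I * (b * d) ^ 2 * t) := by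
      rw [← Complex.exp_nat_mul, ← Complex.exp_add]
      rw [show (4 : ℕ) * (Real.pi * I * (b * d * t - a * c) ^ 2 / 4 / t) +
        Real.pi * I * (a * c) ^ 2 * (-1 / t) = Real.pi * I * (b * d) ^ 2 * t
        + ((-(a * b * c * d) : ℤ) : ℂ) * (2 * Real.pi * I) by
          push_cast; field_simp; ring, Complex.exp_add, Complex.exp_int_mul_two_pi_mul_I, mul_one]
    have e2 : ((-1 : ℂ)) ^ (-a * d) = (-1) * (-1) ^ (b * c) := by
      rw [← zpow_one_add₀ (by norm_num)]
      exact neg_one_zpow_congr ⟨-(1 + b * c), by linarith⟩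
    rw [mul_pow, mul_pow, h4, sqrtNegI_pow_four, e2, ← e1, ej]
    push_cast
    field_simp
    ring
  · have hz := hz (z / t)
    rw [ej] at hz
    have e3 : z / t / ((d * t - c) / t) = z / (d * t + ((-c : ℤ) : ℂ)) := by
      push_cast
      rw [← sub_eq_add_neg, div_div_div_cancel_right₀ ht0]
    have e4 : ((a : ℂ) * (-1 / t) + b) / ((d * t - c) / t) =
        (b * t + ((-a : ℤ) : ℂ)) / (d * t + ((-c : ℤ) : ℂ)) := by
      push_cast
      field_simp
      ring
    have e5 : z / t + (a * c * (-1 / t) + b * d) / 2 = (z + (b * d * t - a * c) / 2) / t := by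
      field_simp
      ring
    rw [e3, e4, e5, jacobiTheta₂_neg_inv ht0] at hz
    have e6 : z + (b * d * t + ((-a : ℤ) : ℂ) * ((-c : ℤ) : ℂ)) / 2 =
        z + (b * d * t - a * c) / 2 + ((a * c : ℤ) : ℂ) := by push_cast; ring
    rw [hz, e6, jacobiTheta₂_add_int]
    have e7 : cexp (Real.pi * I * (c * (z / t) ^ 2 / ((d * t - c) / t) + a * c * (z / t))) *
        cexp (Real.pi * I * (z + (b * d * t - a * c) / 2) ^ 2 / t) =
        cexp (Real.pi * I * (b * d * t - a * c) ^ 2 / 4 / t) *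
        cexp (Real.pi * I * (d * z ^ 2 / (d * t + ((-c : ℤ) : ℂ)) + b * d * z)) := by
      rw [← Complex.exp_add, ← Complex.exp_add]
      push_cast
      rw [← sub_eq_add_neg]
      congr 1
      have hc : (c : ℂ) = d * t - (d * t - c) := by ring
      generalize (d : ℂ) * t - c = J at hj hc ⊢
      rw [hc]
      field_simp
      ring
    linear_combination κ * sqrtNegI t * jacobiTheta₂ (z + (b * d * t - a * c) / 2) t * e7

lemma ThetaTransforms.neg (h : ThetaTransforms a b c d) :
    ThetaTransforms (-a) (-b) (-c) (-d) := by
  intro t ht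
  obtain ⟨κ, h4, hz⟩ := h t ht
  have e : ((-c : ℤ) : ℂ) * t + ((-d : ℤ) : ℂ) = -(c * t + d) := by push_cast; ring
  have e' : ((-a : ℤ) : ℂ) * t + ((-b : ℤ) : ℂ) = -(a * t + b) := by push_cast; ring
  refine ⟨κ, ?_, fun z => ?_⟩
  · rw [h4, e, neg_mul_neg]
    push_cast
    ring_nf
  · rw [e, e', neg_div_neg_eq, div_neg, jacobiTheta₂_neg_left, hz z]
    push_cast
    simp only [div_neg, neg_mul, mul_neg, neg_neg, neg_div]

lemma det_fin_two_eq_one (γ : SL(2, ℤ)) : γ 0 0 * γ 1 1 - γ 0 1 * γ 1 0 = 1 := by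
  have := γ.det_coe
  rwa [Matrix.det_fin_two] at this

/-- Induction over words in S and T, multiplying on the right so that each step only substitutes for
`t`. The constant is controlled only through its fourth power, which avoids all choices of roots. -/
theorem thetaTransforms (γ : SL(2, ℤ)) :
    ThetaTransforms (γ 0 0) (γ 0 1) (γ 1 0) (γ 1 1) := by
  have hγ : γ ∈ Subgroup.closure {ModularGroup.S, ModularGroup.T} := by
    rw [SpecialLinearGroup.SL2Z_generators]
    trivial
  have hS (x : SL(2, ℤ)) (h : ThetaTransforms (x 0 0) (x 0 1) (x 1 0) (x 1 1)) :
      ThetaTransforms ((x * ModularGroup.S) 0 0) ((x * ModularGroup.S) 0 1)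
        ((x * ModularGroup.S) 1 0) ((x * ModularGroup.S) 1 1) := by
    simpa [ModularGroup.coe_S, Matrix.mul_apply, Fin.sum_univ_two]
      using h.mul_S (det_fin_two_eq_one x)
  induction hγ using Subgroup.closure_induction_right with
  | one => 
    intro t ht
    exact ⟨1, by simp, fun z => by simp⟩
  | mul_right x hx y hy ih =>
    rcases hy with rfl | rfl
    · exact hS x ih
    · simpa [ModularGroup.coe_T, Matrix.mul_apply, Fin.sum_univ_two, add_comm]
        using ih.mul_T (det_fin_two_eq_one x)
  | mul_inv_cancel x hx y hy ih =>
    rcases hy with rfl | rfl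
    -- The inverse of S is -S.
    · have h := (hS x ih).neg
      rw [ModularGroup.S_inv, mul_neg]
      simpa using h
    · simpa [ModularGroup.coe_T_inv, Matrix.mul_apply, Fin.sum_univ_two, sub_eq_add_neg, add_comm]
        using ih.mul_T_inv (det_fin_two_eq_one x)

end Inversion

end HalfIntegral

namespace HalfIntegral

open Complex Filter Topology

/-! ### A common automorphy factor for θ(τ) and η(24τ) on Γ₀(576) -/

section GammaZero

variable {a b c d : ℤ} {t : ℂ}

/-- The transformation law of the twelfth-torsion values of `Θ(z, t)` under
`(a 2b; 288c d)`. -/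
lemma ThetaTransforms.torsion (h : ThetaTransforms a (2 * b) (288 * c) d)
    (hdet : a * d - 2 * b * (288 * c) = 1) (ht : 0 < t.im) :
    ∃ κ : ℂ, κ ^ 4 = (288 * c * t + d) ^ 2 ∧ ∀ j : ℤ,
      jacobiTheta₂ (j / 12) ((a * t + 2 * b) / (288 * c * t + d)) =
        κ * jacobiTheta₂ (((d * j : ℤ) : ℂ) / 12) t := by
  obtain ⟨κ, h4, hz⟩ := h t ht
  have hJ := intCast_mul_add_ne_zero hdet ht
  push_cast at h4 hz hJ
  -- The extra factor undoes the half-characteristic in `t`; its fourth power cancels the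
  -- exponential in `h4`.
  refine ⟨κ * cexp (-Real.pi * I * (144 * a * c) ^ 2 * t), ?_, fun j => ?_⟩
  · have e : ((-1 : ℂ)) ^ (2 * b * (288 * c)) = 1 := by
      rw [mul_assoc, zpow_mul]
      simp
    rw [mul_pow, h4, e, ← Complex.exp_nat_mul, mul_assoc, ← Complex.exp_add]
    ring_nf
    simp
  · have hz := hz ((288 * c * t + d) * (j / 12))
    rw [mul_div_cancel_left₀ _ hJ] at hz
    -- The entries 2b and 288c make the total shift a lattice vector: 24cj + 144ac and bd are
    -- integers.
    have e1 : (288 * c * t + d) * ((j : ℂ) / 12) + (a * (288 * c) * t + 2 * b * d) / 2 =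
        ((d * j : ℤ) : ℂ) / 12 + ((24 * c * j + 144 * a * c : ℤ) : ℂ) * t + ((b * d : ℤ) : ℂ) := by
      push_cast
      ring
    rw [hz, e1, jacobiTheta₂_add_int, jacobiTheta₂_add_int_mul, ← mul_assoc, mul_assoc κ,
      ← Complex.exp_add]
    congr 2
    have e2 : (288 * c * ((288 * c * t + d) * ((j : ℂ) / 12)) ^ 2 / (288 * c * t + d)) =
        288 * c * (288 * c * t + d) * (j / 12) ^ 2 := by
      field_simp
    rw [e2, show Real.pi * I * (288 * c * (288 * c * t + d) * ((j : ℂ) / 12) ^ 2 +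
        a * (288 * c) * ((288 * c * t + d) * (j / 12))) +
        -Real.pi * I * (((24 * c * j + 144 * a * c : ℤ) : ℂ) ^ 2 * t +
          2 * ((24 * c * j + 144 * a * c : ℤ) : ℂ) * (((d * j : ℤ) : ℂ) / 12)) =
        -Real.pi * I * (144 * a * c) ^ 2 * t + ((-(c * d * j ^ 2) : ℤ) : ℂ) * (2 * Real.pi * I) by
          push_cast; ring, Complex.exp_add, Complex.exp_int_mul_two_pi_mul_I, mul_one]

/-- `χ₁₂(n)` for an integer `n`. -/
def chi12' (n : ℤ) : ℤ := chi12Int (n : ZMod 12)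

lemma chi12_intCast {n : ℤ} (hn : IsCoprime n 576) : chi12 (n : ZMod 576) = chi12' n := by
  have hu : IsUnit ((n : ℤ) : ZMod 576) := by
    rw [ZMod.coe_int_isUnit_iff_isCoprime]
    exact_mod_cast hn.symm
  have h := DirichletCharacter.changeLevel_eq_cast_of_dvd
    (chi12Int.ringHomComp (Int.castRingHom ℂ)) (show 12 ∣ 576 by norm_num) hu.unit
  rw [hu.unit_spec] at h
  rw [chi12, h]
  simp [chi12']

lemma isCoprime_576_of_twelve {n : ℤ} (hn : IsCoprime n 12) : IsCoprime n 576 := by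
  have : (576 : ℤ) ∣ 12 ^ 3 := by norm_num
  exact (hn.pow_right (n := 3)).of_isCoprime_of_dvd_right this

lemma emod_twelve_of_isCoprime {n : ℤ} (hn : IsCoprime n 12) :
    n % 12 = 1 ∨ n % 12 = 5 ∨ n % 12 = 7 ∨ n % 12 = 11 := by
  have h2 : ¬ (2 : ℤ) ∣ n := fun h => by
    have := hn.isUnit_of_dvd' h (by norm_num)
    simp [Int.isUnit_iff] at this
  have h3 : ¬ (3 : ℤ) ∣ n := fun h => by
    have := hn.isUnit_of_dvd' h (by norm_num)
    simp [Int.isUnit_iff] at this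
  omega

lemma chi12'_of_emod {n r : ℤ} (h : n % 12 = r) : chi12' n = chi12' r := by
  rw [chi12', chi12', ← h]
  exact congrArg chi12Int (ZMod.intCast_mod n 12).symm

/-- A function of `n mod 12` that is even satisfies `f(n) - f(5n) = χ₁₂(n) (f(1) - f(5))`. -/
lemma sub_eq_chi12'_mul {f : ℤ → ℂ} (hper : Function.Periodic f 12) (heven : ∀ n, f (-n) = f n)
    {n : ℤ} (hn : IsCoprime n 12) : f n - f (5 * n) = chi12' n * (f 1 - f 5) := by
  have hmod (i : ℤ) : f i = f (i % 12) := by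
    have := hper.int_mul (i / 12) (i % 12)
    simp only [Int.cast_id] at this
    rw [← this, Int.emod_add_ediv_mul]
  have h7 : f 7 = f 5 := by rw [← heven 5, hmod (-5)]; rfl
  have h11 : f 11 = f 1 := by rw [← heven 1, hmod (-1)]; rfl
  have h := emod_twelve_of_isCoprime hn
  have key (r s : ℤ) (hr : n % 12 = r) (hs : (5 * n) % 12 = s) (e : ℤ) (he : chi12' r = e)
      (hrs : f r - f s = e * (f 1 - f 5)) : f n - f (5 * n) = chi12' n * (f 1 - f 5) := by
    rw [hmod n, hmod (5 * n), chi12'_of_emod hr, he, hr, hs, hrs]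
  rcases h with h | h | h | h
  · exact key 1 5 h (by omega) 1 (by decide) (by push_cast; ring)
  · exact key 5 1 h (by omega) (-1) (by decide) (by push_cast; ring)
  · exact key 7 11 h (by omega) (-1) (by decide) (by rw [h7, h11]; push_cast; ring)
  · exact key 11 7 h (by omega) 1 (by decide) (by rw [h7, h11]; push_cast; ring)

lemma coe_mul24 (τ : ℍ) : (mul24 τ : ℂ) = 24 * τ := rfl

/-- `θ(τ)` and `η(24τ)` have the same automorphy factor on `Γ₀(576)`, up to `χ₁₂`. -/
theorem exists_theta_factor {γ : SL(2, ℤ)} (hγ : γ ∈ CongruenceSubgroup.Gamma0 576) (τ : ℍ) :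
    ∃ κ : ℂ, κ ^ 4 = ((γ 1 0 : ℤ) * (τ : ℂ) + (γ 1 1 : ℤ)) ^ 2 ∧
      theta (γ • τ) = κ * theta τ ∧
      ModularForm.eta (mul24 (γ • τ)) =
        chi12 ((γ 1 1 : ℤ) : ZMod 576) * κ * ModularForm.eta (mul24 τ) := by
  have hdet := det_fin_two_eq_one γ
  have hcoe : ((γ • τ : ℍ) : ℂ) = ((γ 0 0 : ℤ) * (τ : ℂ) + (γ 0 1 : ℤ)) /
      ((γ 1 0 : ℤ) * (τ : ℂ) + (γ 1 1 : ℤ)) := by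
    rw [UpperHalfPlane.coe_specialLinearGroup_apply]
    simp
  rw [CongruenceSubgroup.Gamma0_mem, ZMod.intCast_zmod_eq_zero_iff_dvd] at hγ
  generalize γ • τ = τ' at hcoe ⊢
  generalize γ 0 0 = a at *
  generalize γ 0 1 = b at *
  generalize γ 1 0 = c' at *
  generalize γ 1 1 = d at *
  obtain ⟨c, rfl⟩ := hγ
  have hdet' : a * d - 2 * b * (288 * c) = 1 := by push_cast at hdet; linarith
  have hcop : IsCoprime d 12 := ⟨a, -48 * b * c, by linarith⟩
  have ht : 0 < (2 * (τ : ℂ)).im := by simpa using τ.im_pos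
  -- The action of γ on τ becomes that of (a 2b; 288c d) on 2τ. The same `κ` serves j = 0 for theta
  -- and j = 1, 5 for eta.
  obtain ⟨κ, h4, hκ⟩ := (thetaTransforms ⟨!![a, 2 * b; 288 * c, d], by
    rw [Matrix.det_fin_two_of]; exact hdet'⟩).torsion (b := b) (c := c) hdet' ht
  simp only [Matrix.of_apply, Matrix.cons_val', Matrix.cons_val_zero, Matrix.cons_val_fin_one,
    Matrix.cons_val_one] at h4 hκ
  have hτ' : (a * (2 * (τ : ℂ)) + 2 * b) / (288 * c * (2 * (τ : ℂ)) + d) = 2 * τ' := by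
    rw [hcoe]
    push_cast
    ring
  rw [hτ'] at hκ
  refine ⟨κ, ?_, ?_, ?_⟩
  · rw [h4]
    push_cast
    ring
  · have := hκ 0
    simpa [theta, jacobiTheta_eq_jacobiTheta₂] using this
  · have e (z : ℍ) := sqrt_mul_eta_eq (mul24 z).im_pos
    have h12 : ((√12 : ℝ) : ℂ) ≠ 0 := by simp
    have e12 (z : ℍ) : (mul24 z : ℂ) / 12 = 2 * z := by rw [coe_mul24]; ring
    have hsub := sub_eq_chi12'_mul (f := fun j => jacobiTheta₂ ((j : ℂ) / 12) (2 * τ)) (n := d)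
      (fun j => by
        simp only
        rw [show ((j + 12 : ℤ) : ℂ) / 12 = j / 12 + 1 by push_cast; ring, jacobiTheta₂_add_left])
      (fun j => by
        rw [Int.cast_neg, neg_div, jacobiTheta₂_neg_left]) hcop
    have h1 := hκ 1
    have h5 := hκ 5
    rw [mul_comm d 5] at h5
    rw [mul_one] at h1
    push_cast at h1 h5 hsub
    apply mul_left_cancel₀ h12
    have et := e τ
    have et' := e τ'
    simp only [e12] at et et'
    rw [chi12_intCast (isCoprime_576_of_twelve hcop)]
    linear_combination et' + h1 - h5 + κ * hsub - chi12' d * κ * et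

end GammaZero

end HalfIntegral

namespace HalfIntegral

open Complex Filter Topology

/-! ### The eta multiplier of (24A B; c 24D) as a quadratic Gauss sum -/

section QuadraticGaussSum

variable {c : ℕ} [NeZero c]

/-- The quadratic Gauss sum `∑_{j mod c} exp(2πi A j² / c)`. -/
noncomputable def quadGaussSum (c : ℕ) [NeZero c] (A : ZMod c) : ℂ :=
  ∑ j : ZMod c, ZMod.stdAddChar (A * j ^ 2)

lemma sum_fin_eq_sum_zmod (f : ZMod c → ℂ) :
    ∑ j : Fin c, f ((j : ℕ) : ZMod c) = ∑ j : ZMod c, f j := by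
  refine Fintype.sum_equiv (ZMod.finEquiv c).toEquiv _ _ fun j => ?_
  cases c with
  | zero => exact (NeZero.ne 0 rfl).elim
  | succ n => exact congrArg f (Fin.cast_val_eq_self j)

/-- Completing the square: `288 * D * n` is `n` divided by `2 * A`, because `576 * A * D = 1`. -/
lemma sum_stdAddChar_quadratic {A D : ZMod c} (h : 576 * A * D = 1) (n : ZMod c) :
    ∑ j : ZMod c, ZMod.stdAddChar (A * j ^ 2 - n * j) =
      ZMod.stdAddChar (-144 * D * n ^ 2) * quadGaussSum c A := by
  rw [quadGaussSum, Finset.mul_sum]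
  refine Fintype.sum_equiv (Equiv.subRight (288 * D * n)) _ _ fun j => ?_
  rw [← AddChar.map_add_eq_mul]
  congr 1
  simp only [Equiv.subRight_apply]
  linear_combination (j * n - 144 * D * n ^ 2) * h

lemma jacobiTheta₂_add_two_mul_int (z t : ℂ) (n : ℤ) :
    jacobiTheta₂ z (t + 2 * n) = jacobiTheta₂ z t := by
  have hp : Function.Periodic (jacobiTheta₂ z) 2 := fun t => jacobiTheta₂_add_right z t
  have := hp.int_mul n t
  rwa [mul_comm 2 (n : ℂ)]

/-- Summation of a theta function against quadratic exponentials, by completing the square. -/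
lemma sum_stdAddChar_mul_jacobiTheta₂ {A D : ℤ} (h : (576 * A * D : ZMod c) = 1) (v : ℂ) {t : ℂ}
    (ht : 0 < t.im) :
    ∑ j : Fin c, cexp (2 * Real.pi * I * (A * (j : ℕ) ^ 2) / c) *
        jacobiTheta₂ (v - (j : ℕ) / c) (t + 288 * D / c) =
      quadGaussSum c (A : ZMod c) * jacobiTheta₂ v t := by
  have hc0 : (c : ℂ) ≠ 0 := by exact_mod_cast NeZero.ne c
  have hc1 : 0 < (t + 288 * D / c).im := by
    have : (288 * D / c : ℂ) = ((288 * D / c : ℝ) : ℂ) := by push_cast; rfl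
    rw [this]
    simpa using ht
  have h1 := hasSum_sum (f := fun (j : Fin c) (n : ℤ) =>
      cexp (2 * Real.pi * I * (A * (j : ℕ) ^ 2) / c) *
        jacobiTheta₂_term n (v - (j : ℕ) / c) (t + 288 * D / c)) (s := Finset.univ)
    (fun j _ => (hasSum_jacobiTheta₂_term _ hc1).mul_left _)
  refine h1.unique ?_
  refine ((hasSum_jacobiTheta₂_term v ht).mul_left (quadGaussSum c (A : ZMod c))).congr_fun
    fun n => ?_
  have h2 := sum_stdAddChar_quadratic h (n : ZMod c)
  rw [← sum_fin_eq_sum_zmod] at h2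
  have h3 (j : Fin c) : ZMod.stdAddChar ((A : ZMod c) * ((j : ℕ) : ZMod c) ^ 2 -
      (n : ZMod c) * ((j : ℕ) : ZMod c)) =
        cexp (2 * Real.pi * I * (A * (j : ℕ) ^ 2 - n * (j : ℕ)) / c) := by
    have := ZMod.stdAddChar_coe (N := c) (A * (j : ℕ) ^ 2 - n * (j : ℕ))
    push_cast at this
    exact this
  have h4 : ZMod.stdAddChar (-144 * (D : ZMod c) * (n : ZMod c) ^ 2) =
      cexp (2 * Real.pi * I * (-144 * D * n ^ 2) / c) := by
    have := ZMod.stdAddChar_coe (N := c) (-144 * D * n ^ 2)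
    push_cast at this
    exact this
  simp only [h3, h4] at h2
  have h5 (j : Fin c) : cexp (2 * Real.pi * I * (A * (j : ℕ) ^ 2) / c) *
      jacobiTheta₂_term n (v - (j : ℕ) / c) (t + 288 * D / c) =
      cexp (2 * Real.pi * I * (A * (j : ℕ) ^ 2 - n * (j : ℕ)) / c) *
      (cexp (2 * Real.pi * I * (144 * D * n ^ 2) / c) * jacobiTheta₂_term n v t) := by
    simp only [jacobiTheta₂_term, ← Complex.exp_add]
    congr 1
    field_simp
    ring
  -- The shift 288D/c of the modulus contributes the phase 144Dn²/c, which cancels the one left by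
  -- completing the square.
  rw [Finset.sum_congr rfl fun j _ => h5 j, ← Finset.sum_mul, h2, mul_comm (cexp _), mul_assoc,
    ← mul_assoc (cexp _), ← Complex.exp_add]
  ring_nf
  simp

/-- The values of theta at twelfth-torsion points under `(24A B; c 24D)`. -/
lemma jacobiTheta₂_torsion_gaussSum {A B D : ℤ} (hdet : 24 * A * (24 * D) - B * c = 1) {w : ℂ}
    (hw : 0 < w.im) (i : ℤ) :
    jacobiTheta₂ (i / 12) ((24 * A * w + B) / (c * w + 24 * D) / 12) =
      sqrtNegI (12 / c * (c * w + 24 * D)) * quadGaussSum c (A : ZMod c) *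
        thetaSeries12 (i * c) w := by
  have hc0 : (c : ℂ) ≠ 0 := by exact_mod_cast NeZero.ne c
  have hcr : (0 : ℝ) < c := by exact_mod_cast NeZero.pos c
  have hWim : ((c : ℂ) * w + 24 * D).im = c * w.im := by
    have : (24 * D : ℂ) = ((24 * D : ℝ) : ℂ) := by push_cast; rfl
    rw [this]
    simp
  have hW : 0 < ((c : ℂ) * w + 24 * D).im := by rw [hWim]; positivity
  have hW0 : (c : ℂ) * w + 24 * D ≠ 0 := fun h => by rw [h] at hW; simp at hW
  have hdetC : (24 * A * (24 * D) - B * c : ℂ) = 1 := by exact_mod_cast hdet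
  have h576 : (576 * A * D : ZMod c) = 1 := by
    have := congrArg (Int.cast : ℤ → ZMod c) hdet
    push_cast at this
    rw [ZMod.natCast_self] at this
    linear_combination this
  obtain ⟨W, hWdef⟩ : ∃ W, W = (c : ℂ) * w + 24 * D := ⟨_, rfl⟩
  rw [← hWdef] at hW hW0 ⊢
  have hs0 : 12 / (c : ℂ) * W ≠ 0 := by simp [hc0, hW0]
  -- By the determinant condition, the image point is the rational number 2A/c plus an inverted
  -- point. Splitting the theta series modulo `c` multiplies the modulus by c², so 2A/c becomes an
  -- even integer and disappears.
  have hτ : (24 * A * w + B) / W / 12 = 2 * A / c + -1 / (12 * c * W) := by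
    field_simp
    rw [hWdef]
    linear_combination -hdetC
  have hτim : 0 < ((24 * A * w + B) / W / 12).im := by
    have e : 2 * (A : ℂ) / c = ((2 * A / c : ℝ) : ℂ) := by push_cast; rfl
    have e' : -1 / (12 * c * W) = ((1 / (12 * c) : ℝ) : ℂ) * (-1 / W) := by
      push_cast
      field_simp
    rw [hτ, e, e', Complex.add_im, Complex.ofReal_im, zero_add, Complex.im_ofReal_mul]
    have := im_neg_inv_pos hW
    positivity
  rw [jacobiTheta₂_eq_sum_residues c _ hτim]
  have key (j : Fin c) : cexp (2 * Real.pi * I * (j : ℕ) * (i / 12) + Real.pi * I * (j : ℕ) ^ 2 *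
      ((24 * A * w + B) / W / 12)) * jacobiTheta₂ (c * (i / 12) + c * (j : ℕ) *
      ((24 * A * w + B) / W / 12)) (c ^ 2 * ((24 * A * w + B) / W / 12)) =
      sqrtNegI (12 / c * W) * cexp (Real.pi * I * (c * i ^ 2 / 12 * W)) *
        (cexp (2 * Real.pi * I * (A * (j : ℕ) ^ 2) / c) *
        jacobiTheta₂ (W * i - (j : ℕ) / c) (12 * w + 288 * D / c)) := by
    have e1 : (c : ℂ) * (i / 12) + c * (j : ℕ) * (2 * A / c + -1 / (12 * c * W)) =
        (W * i - (j : ℕ) / c) / (12 / c * W) + ((2 * A * (j : ℕ) : ℤ) : ℂ) := by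
      push_cast
      field_simp
      ring
    have e2 : (c : ℂ) ^ 2 * (2 * A / c + -1 / (12 * c * W)) =
        -1 / (12 / c * W) + 2 * ((A * c : ℤ) : ℂ) := by
      push_cast
      field_simp
      ring
    have e3 : 12 / (c : ℂ) * W = 12 * w + 288 * D / c := by
      rw [hWdef]
      field_simp
      ring
    rw [hτ, e1, e2, jacobiTheta₂_add_int, jacobiTheta₂_add_two_mul_int, jacobiTheta₂_neg_inv hs0,
      ← e3]
    rw [show ∀ p q r s : ℂ, p * (q * r * s) = q * (p * r) * s by intros; ring,
      show ∀ p q r s : ℂ, p * q * (r * s) = p * (q * r) * s by intros; ring,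
      ← Complex.exp_add, ← Complex.exp_add]
    congr 3
    field_simp
    ring
  rw [Finset.sum_congr rfl fun j _ => key j, ← Finset.mul_sum,
    sum_stdAddChar_mul_jacobiTheta₂ h576 _ (by simpa using hw), thetaSeries12]
  have e4 : W * i = ((i * c : ℤ) : ℂ) * w + ((24 * D * i : ℤ) : ℂ) := by
    rw [hWdef]
    push_cast
    ring
  have e5 : cexp (Real.pi * I * (c * i ^ 2 / 12 * W)) =
      cexp (Real.pi * I * ((i * c : ℤ) : ℂ) ^ 2 * w / 12) := by
    rw [hWdef, show Real.pi * I * ((c : ℂ) * i ^ 2 / 12 * (c * w + 24 * D)) =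
      Real.pi * I * ((i * c : ℤ) : ℂ) ^ 2 * w / 12 + ((c * D * i ^ 2 : ℤ) : ℂ) *
        (2 * Real.pi * I) by push_cast; ring, Complex.exp_add, Complex.exp_int_mul_two_pi_mul_I,
      mul_one]
  rw [e4, jacobiTheta₂_add_int, e5]
  ring

/-- The transformation of `η` under `(24A B; c 24D)` in terms of a quadratic Gauss sum. -/
theorem eta_gaussSum {A B D : ℤ} (hdet : 24 * A * (24 * D) - B * c = 1) {w : ℂ}
    (hw : 0 < w.im) :
    ModularForm.eta ((24 * A * w + B) / (c * w + 24 * D)) =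
      chi12' c * (quadGaussSum c (A : ZMod c) / √c) * sqrtNegI (c * w + 24 * D) *
        ModularForm.eta w := by
  have hcr : (0 : ℝ) < c := by exact_mod_cast NeZero.pos c
  have hWim : ((c : ℂ) * w + 24 * D).im = c * w.im := by
    have : (24 * D : ℂ) = ((24 * D : ℝ) : ℂ) := by push_cast; rfl
    rw [this]
    simp
  have hW : 0 < ((c : ℂ) * w + 24 * D).im := by rw [hWim]; positivity
  have hW0 : (c : ℂ) * w + 24 * D ≠ 0 := fun h => by rw [h] at hW; simp at hW
  have hγim : 0 < ((24 * A * w + B) / (c * w + 24 * D)).im := by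
    have e : (24 * A * w + B) / (c * w + 24 * D) = ((24 * A / c : ℝ) : ℂ) +
        ((1 / c : ℝ) : ℂ) * (-1 / (c * w + 24 * D)) := by
      have hc0 : (c : ℂ) ≠ 0 := by exact_mod_cast NeZero.ne c
      have hdetC : (24 * A * (24 * D) - B * c : ℂ) = 1 := by exact_mod_cast hdet
      obtain ⟨W, hWdef⟩ : ∃ W, W = (c : ℂ) * w + 24 * D := ⟨_, rfl⟩
      rw [← hWdef] at hW0 ⊢
      push_cast
      field_simp
      rw [hWdef]
      linear_combination -hdetC
    rw [e, Complex.add_im, Complex.ofReal_im, zero_add, Complex.im_ofReal_mul]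
    have := im_neg_inv_pos hW
    positivity
  have hcop : IsCoprime (c : ℤ) 12 := ⟨-B, 48 * A * D, by linarith⟩
  have h := sqrt_mul_eta_eq hγim
  have h1 := jacobiTheta₂_torsion_gaussSum hdet hw 1
  have h5 := jacobiTheta₂_torsion_gaussSum hdet hw 5
  have hsub := sub_eq_chi12'_mul (f := fun j => thetaSeries12 j w)
    (fun j => thetaSeries12_add j w) (fun j => thetaSeries12_neg j w) hcop
  have hη := eta_eq_thetaSeries12 hw
  have hs := sqrtNegI_ofReal_mul (a := 12 / c) (by positivity) hW0
  rw [Real.sqrt_div (by norm_num)] at hs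
  rw [one_mul] at h1
  push_cast at h1 h5 hs
  have h12 : ((√12 : ℝ) : ℂ) ≠ 0 := by simp
  rw [hs] at h1 h5
  apply mul_left_cancel₀ h12
  -- The torsion points 1/12 and 5/12 lead to the classes c and 5c modulo 12, whose difference is
  -- χ₁₂(c) times the difference for 1 and 5.
  linear_combination h + h1 - h5 + (√12 : ℝ) / (√c : ℝ) * sqrtNegI (c * w + 24 * D) *
    quadGaussSum c (A : ZMod c) * (hsub - chi12' c * hη)

end QuadraticGaussSum

end HalfIntegral

namespace HalfIntegral

open Complex Filter Topology

/-! ### Gauss sums modulo ℓ and ℓ² -/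

section GaussSums

variable (ℓ : ℕ) [Fact ℓ.Prime]

/-- The Legendre symbol modulo `ℓ` as a complex-valued character. -/
noncomputable def legendreChar : MulChar (ZMod ℓ) ℂ :=
  (quadraticChar (ZMod ℓ)).ringHomComp (Int.castRingHom ℂ)

/-- The Gauss sum of the Legendre symbol. -/
noncomputable def legendreGaussSum : ℂ := gaussSum (legendreChar ℓ) ZMod.stdAddChar

variable {ℓ}

lemma legendreChar_intCast (n : ℤ) : legendreChar ℓ (n : ZMod ℓ) = legendreSym ℓ n := rfl

lemma legendreChar_isQuadratic : (legendreChar ℓ).IsQuadratic :=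
  (quadraticChar_isQuadratic (ZMod ℓ)).comp _

lemma ringChar_zmod_ne_two (hℓ : ℓ ≠ 2) : ringChar (ZMod ℓ) ≠ 2 := by
  rwa [ZMod.ringChar_zmod_n]

lemma legendreChar_ne_one (hℓ : ℓ ≠ 2) : legendreChar ℓ ≠ 1 := by
  rw [legendreChar, MulChar.ringHomComp_ne_one_iff (RingHom.injective_int _)]
  exact quadraticChar_ne_one (ringChar_zmod_ne_two hℓ)

lemma legendreGaussSum_sq (hℓ : ℓ ≠ 2) :
    legendreGaussSum ℓ ^ 2 = legendreChar ℓ (-1) * ℓ := by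
  have := gaussSum_sq (legendreChar_ne_one hℓ) legendreChar_isQuadratic
    (ZMod.isPrimitive_stdAddChar ℓ)
  rwa [ZMod.card] at this

lemma sum_legendreChar_mul_stdAddChar (hℓ : ℓ ≠ 2) (n : ZMod ℓ) :
    ∑ u : ZMod ℓ, legendreChar ℓ u * ZMod.stdAddChar (n * u) =
      legendreChar ℓ n * legendreGaussSum ℓ := by
  rcases eq_or_ne n 0 with rfl | hn
  · simp [MulChar.sum_eq_zero_of_ne_one (legendreChar_ne_one hℓ), MulChar.map_zero]
  · have h := gaussSum_mulShift_eq (legendreChar ℓ) (ZMod.stdAddChar (N := ℓ)) (Units.mk0 n hn)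
    rw [legendreChar_isQuadratic.inv] at h
    simpa [gaussSum, legendreGaussSum, AddChar.mulShift_apply] using h

/-- An element x has 1 + (x/ℓ) square roots, and the constant 1 sums to zero against a nontrivial
additive character. -/
lemma quadGaussSum_prime (hℓ : ℓ ≠ 2) {A : ZMod ℓ} (hA : A ≠ 0) :
    quadGaussSum ℓ A = legendreChar ℓ A * legendreGaussSum ℓ := by
  have h1 : quadGaussSum ℓ A =
      ∑ x : ZMod ℓ, (legendreChar ℓ x + 1) * ZMod.stdAddChar (A * x) := by
    rw [quadGaussSum, ← Finset.sum_fiberwise_of_maps_to (t := Finset.univ)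
      (g := fun j : ZMod ℓ => j ^ 2) (fun _ _ => Finset.mem_univ _)]
    refine Finset.sum_congr rfl fun x _ => ?_
    rw [Finset.sum_congr rfl (g := fun _ => ZMod.stdAddChar (A * x)) (by
      intro j hj
      rw [(Finset.mem_filter.mp hj).2])]
    rw [Finset.sum_const, nsmul_eq_mul]
    congr 1
    have h := quadraticChar_card_sqrts (ringChar_zmod_ne_two hℓ) x
    have h' : ((((({y : ZMod ℓ | y ^ 2 = x} : Set (ZMod ℓ)).toFinset).card : ℤ) : ℂ)) =
      legendreChar ℓ x + 1 := by rw [h]; push_cast; rfl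
    rw [← h', Int.cast_natCast]
    congr 2
    ext y
    simp
  have h2 : ∑ x : ZMod ℓ, ZMod.stdAddChar (A * x) = (0 : ℂ) := by
    have := AddChar.sum_mulShift A (ZMod.isPrimitive_stdAddChar ℓ)
    simpa [hA, mul_comm] using this
  simp_rw [h1, add_mul, one_mul]
  rw [Finset.sum_add_distrib, h2, add_zero, sum_legendreChar_mul_stdAddChar hℓ]

instance : NeZero (ℓ ^ 2) := ⟨pow_ne_zero 2 (Fact.out : ℓ.Prime).ne_zero⟩

/-- A sum modulo `ℓ²`, split into the units and the multiples of `ℓ`. -/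
lemma sum_zmod_sq (φ : ZMod (ℓ ^ 2) → ℂ) :
    ∑ b, φ b = ∑ u : (ZMod (ℓ ^ 2))ˣ, φ u + ∑ v : ZMod ℓ, φ ((ℓ * v.val : ℕ) : ZMod (ℓ ^ 2)) := by
  classical
  have hp : ℓ.Prime := Fact.out
  rw [← Finset.sum_filter_add_sum_filter_not _ (fun b => IsUnit b)]
  congr 1
  · symm
    refine Finset.sum_bij (fun u _ => (u : ZMod (ℓ ^ 2))) (fun u _ => by simp)
      (fun u _ v _ h => Units.ext h) (fun b hb => ?_) (fun _ _ => rfl)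
    exact ⟨(Finset.mem_filter.mp hb).2.unit, Finset.mem_univ _, rfl⟩
  · symm
    refine Finset.sum_bij (fun v _ => ((ℓ * v.val : ℕ) : ZMod (ℓ ^ 2))) (fun v _ => ?_)
      (fun u _ v _ h => ?_) (fun b hb => ?_) (fun _ _ => rfl)
    · rw [Finset.mem_filter, ZMod.isUnit_iff_coprime]
      refine ⟨Finset.mem_univ _, fun h => ?_⟩
      have := Nat.Coprime.coprime_dvd_right (dvd_pow_self ℓ two_ne_zero) h
      exact hp.one_lt.ne' (Nat.Coprime.eq_one_of_dvd this.symm (dvd_mul_right ℓ _))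
    · rw [ZMod.natCast_eq_natCast_iff, sq] at h
      have := Nat.ModEq.mul_left_cancel' hp.ne_zero h
      rw [← ZMod.natCast_eq_natCast_iff] at this
      simpa using this
    · have hb' := (Finset.mem_filter.mp hb).2
      rw [← ZMod.natCast_zmod_val b, ZMod.isUnit_iff_coprime] at hb'
      have hdvd : ℓ ∣ b.val := by
        by_contra hnd
        exact hb' (((hp.coprime_iff_not_dvd.mpr hnd).symm).pow_right 2)
      obtain ⟨v, hv⟩ := hdvd
      have hlt : v < ℓ := by
        have := b.val_lt
        rw [hv, sq] at this
        exact lt_of_mul_lt_mul_left' this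
      refine ⟨(v : ZMod ℓ), Finset.mem_univ _, ?_⟩
      rw [ZMod.val_natCast_of_lt hlt, ← hv, ZMod.natCast_zmod_val]

lemma quadGaussSum_prime_sq (hℓ : ℓ ≠ 2) {A : ZMod (ℓ ^ 2)} (hA : IsUnit A) :
    quadGaussSum (ℓ ^ 2) A = ℓ := by
  classical
  have hp : ℓ.Prime := Fact.out
  have hcard : ((ℓ ^ 2 : ℕ) : ℂ) ≠ 0 := by exact_mod_cast NeZero.ne (ℓ ^ 2)
  have h2 : IsUnit (2 : ZMod (ℓ ^ 2)) := by
    have : IsUnit ((2 : ℕ) : ZMod (ℓ ^ 2)) := by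
      rw [ZMod.isUnit_iff_coprime]
      exact ((Nat.coprime_primes Nat.prime_two hp).mpr hℓ.symm).pow_right 2
    simpa using this
  have hℓ0 : ((ℓ : ZMod (ℓ ^ 2))) ^ 2 = 0 := by
    have := ZMod.natCast_self (ℓ ^ 2)
    push_cast at this
    exact this
  -- Shifting j by ℓv changes the phase only linearly in v, as ℓ² = 0. Averaging over v then kills
  -- every unit j and leaves the ℓ multiples of ℓ, each with phase 1.
  have hshift (v : ZMod (ℓ ^ 2)) : quadGaussSum (ℓ ^ 2) A =
      ∑ j : ZMod (ℓ ^ 2), ZMod.stdAddChar (A * j ^ 2) *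
        ZMod.stdAddChar (v * (2 * A * ((ℓ : ZMod (ℓ ^ 2)) * j))) := by
    rw [quadGaussSum, ← Equiv.sum_comp (Equiv.addRight ((ℓ : ZMod (ℓ ^ 2)) * v))]
    refine Finset.sum_congr rfl fun j _ => ?_
    rw [← AddChar.map_add_eq_mul, Equiv.coe_addRight]
    congr 1
    linear_combination A * v ^ 2 * hℓ0
  have hsum : ((ℓ ^ 2 : ℕ) : ℂ) * quadGaussSum (ℓ ^ 2) A = ((ℓ ^ 2 : ℕ) : ℂ) * ℓ := by
    calc ((ℓ ^ 2 : ℕ) : ℂ) * quadGaussSum (ℓ ^ 2) A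
        = ∑ v : ZMod (ℓ ^ 2), quadGaussSum (ℓ ^ 2) A := by simp
      _ = ∑ j : ZMod (ℓ ^ 2), ZMod.stdAddChar (A * j ^ 2) *
            ∑ v : ZMod (ℓ ^ 2), ZMod.stdAddChar (v * (2 * A * ((ℓ : ZMod (ℓ ^ 2)) * j))) := by
          rw [Finset.sum_congr rfl fun v _ => hshift v, Finset.sum_comm]
          simp_rw [Finset.mul_sum]
      _ = ∑ j : ZMod (ℓ ^ 2), if IsUnit j then 0 else ((ℓ ^ 2 : ℕ) : ℂ) := by
          refine Finset.sum_congr rfl fun j _ => ?_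
          rw [AddChar.sum_mulShift _ (ZMod.isPrimitive_stdAddChar (ℓ ^ 2)), ZMod.card]
          have hz : 2 * A * ((ℓ : ZMod (ℓ ^ 2)) * j) = 0 ↔ (ℓ : ZMod (ℓ ^ 2)) * j = 0 :=
            (h2.mul hA).mul_right_eq_zero
          by_cases hj : IsUnit j
          · have : ¬ (2 * A * ((ℓ : ZMod (ℓ ^ 2)) * j) = 0) := by
              rw [hz, hj.mul_left_eq_zero, ZMod.natCast_eq_zero_iff]
              intro h
              have := Nat.le_of_dvd hp.pos h
              nlinarith [hp.two_le]
            rw [if_pos hj, if_neg this, Nat.cast_zero, mul_zero]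
          · rw [← ZMod.natCast_zmod_val j, ZMod.isUnit_iff_coprime] at hj
            have hdvd : ℓ ∣ j.val := by
              by_contra hnd
              exact hj (((hp.coprime_iff_not_dvd.mpr hnd).symm).pow_right 2)
            obtain ⟨v, hv⟩ := hdvd
            have hj' : j = (ℓ : ZMod (ℓ ^ 2)) * v := by
              rw [← ZMod.natCast_zmod_val j, hv]
              push_cast
              rfl
            have e1 : (ℓ : ZMod (ℓ ^ 2)) * j = 0 := by rw [hj']; linear_combination v * hℓ0
            have e2 : A * j ^ 2 = 0 := by rw [hj']; linear_combination A * v ^ 2 * hℓ0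
            rw [← ZMod.isUnit_iff_coprime, ZMod.natCast_zmod_val] at hj
            rw [if_neg hj, if_pos (hz.mpr e1), e2, AddChar.map_zero_eq_one, one_mul]
      _ = ((ℓ ^ 2 : ℕ) : ℂ) * ℓ := by
          rw [sum_zmod_sq]
          have (v : ZMod ℓ) : ¬ IsUnit ((ℓ * v.val : ℕ) : ZMod (ℓ ^ 2)) := by
            rw [ZMod.isUnit_iff_coprime]
            intro h
            have := Nat.Coprime.coprime_dvd_right (dvd_pow_self ℓ two_ne_zero) h
            exact hp.one_lt.ne' (Nat.Coprime.eq_one_of_dvd this.symm (dvd_mul_right ℓ _))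
          simp [this, mul_comm, -Nat.cast_mul]
  exact mul_left_cancel₀ hcard hsum

end GaussSums

end HalfIntegral

namespace HalfIntegral

open Complex hiding eta
open Filter Topology ModularForm

/-! ### The forms η(24τ)^r F(24τ) are cusp forms -/

section EtaForm

variable {r m k : ℕ}

/-- The form `η(w)^r F(w)`. -/
noncomputable def etaForm (r : ℕ) (F : ModularForm 𝒮ℒ (m : ℤ)) (w : ℍ) : ℂ :=
  eta (w : ℂ) ^ r * F w

lemma coe_SL_smul (γ : SL(2, ℤ)) (τ : ℍ) :
    ((γ • τ : ℍ) : ℂ) = ((γ 0 0 : ℤ) * (τ : ℂ) + (γ 0 1 : ℤ)) /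
      ((γ 1 0 : ℤ) * (τ : ℂ) + (γ 1 1 : ℤ)) := by
  rw [UpperHalfPlane.coe_specialLinearGroup_apply]
  simp

lemma modularForm_SL_smul {n : ℤ} {G : Type*} [FunLike G ℍ ℂ] [SlashInvariantFormClass G 𝒮ℒ n]
    (F : G) (γ : SL(2, ℤ)) (τ : ℍ) :
    F (γ • τ) = ((γ 1 0 : ℤ) * (τ : ℂ) + (γ 1 1 : ℤ)) ^ n * F τ := by
  have h := SlashInvariantForm.slash_action_eqn'' F
    (γ := Matrix.SpecialLinearGroup.mapGL ℝ γ) (MonoidHom.mem_range.mpr ⟨γ, rfl⟩) τ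
  rw [← ModularGroup.denom_apply]
  exact h

lemma eta_pow_SL_smul (γ : SL(2, ℤ)) (τ : ℍ) :
    eta (γ • τ : ℍ) ^ 24 = ((γ 1 0 : ℤ) * (τ : ℂ) + (γ 1 1 : ℤ)) ^ 12 * eta τ ^ 24 :=
  modularForm_SL_smul CuspForm.discriminant γ τ

lemma mdifferentiable_eta : MDifferentiable 𝓘(ℂ) 𝓘(ℂ) (fun w : ℍ => eta (w : ℂ)) := by
  rw [UpperHalfPlane.mdifferentiable_iff]
  refine .congr (fun z hz ↦
    (differentiableAt_eta_of_mem_upperHalfPlaneSet hz).differentiableWithinAt) fun z hz ↦ ?_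
  simp [ofComplex_apply_of_im_pos hz]

lemma mdifferentiable_etaForm (F : ModularForm 𝒮ℒ (m : ℤ)) :
    MDifferentiable 𝓘(ℂ) 𝓘(ℂ) (etaForm r F) :=
  (mdifferentiable_eta.pow r).mul F.holo'

lemma isZeroAtImInfty_eta : IsZeroAtImInfty (fun w : ℍ => eta (w : ℂ)) := by
  have h := discriminant_isZeroAtImInfty
  rw [IsZeroAtImInfty, ZeroAtFilter, Metric.tendsto_nhds] at h ⊢
  intro ε hε
  filter_upwards [h (ε ^ 24) (by positivity)] with w hw
  rw [dist_zero_right, discriminant, norm_pow] at hw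
  rw [dist_zero_right]
  exact lt_of_pow_lt_pow_left₀ 24 hε.le hw

lemma isZeroAtImInfty_etaForm (hr : 1 ≤ r) (F : ModularForm 𝒮ℒ (m : ℤ)) :
    IsZeroAtImInfty (etaForm r F) := by
  have h1 : IsZeroAtImInfty (fun w : ℍ => eta (w : ℂ) ^ r) := by
    have := Filter.Tendsto.pow isZeroAtImInfty_eta r
    rwa [zero_pow (by omega)] at this
  have h2 : IsBoundedAtImInfty F := ModularFormClass.bdd_at_infty F
  have h3 := Asymptotics.IsLittleO.mul_isBigO (Asymptotics.isLittleO_one_iff ℝ |>.mpr h1) h2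
  simp only [Pi.one_apply, mul_one] at h3
  exact (Asymptotics.isLittleO_one_iff ℝ).mp h3

lemma etaForm_pow_SL_smul (F : ModularForm 𝒮ℒ (m : ℤ)) (γ : SL(2, ℤ)) (τ : ℍ) :
    etaForm r F (γ • τ) ^ 24 =
      ((γ 1 0 : ℤ) * (τ : ℂ) + (γ 1 1 : ℤ)) ^ (12 * (r + 2 * m)) * etaForm r F τ ^ 24 := by
  have h := eta_pow_SL_smul γ τ
  rw [etaForm, etaForm, modularForm_SL_smul F, mul_pow, ← pow_mul, mul_comm r 24, pow_mul, h,
    zpow_natCast]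
  generalize ((γ 1 0 : ℤ) : ℂ) * (τ : ℂ) + ((γ 1 1 : ℤ) : ℂ) = J
  ring

lemma isZeroAt_etaForm_pow (hr : 1 ≤ r) (F : ModularForm 𝒮ℒ (m : ℤ)) {c : OnePoint ℝ}
    (hc : IsCusp c 𝒮ℒ) :
    c.IsZeroAt (fun w => etaForm r F w ^ 24) ((12 * (r + 2 * m) : ℕ) : ℤ) := by
  rw [OnePoint.isZeroAt_iff_forall_SL2Z hc]
  intro γ _
  have hinv : (fun w => etaForm r F w ^ 24) ∣[((12 * (r + 2 * m) : ℕ) : ℤ)] γ =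
      fun w => etaForm r F w ^ 24 := by
    funext τ
    have hne : ((γ 1 0 : ℤ) * (τ : ℂ) + (γ 1 1 : ℤ)) ≠ 0 := by
      rw [← ModularGroup.denom_apply]
      exact denom_ne_zero _ _
    rw [SL_slash_apply, ModularGroup.denom_apply, etaForm_pow_SL_smul, zpow_neg, zpow_natCast]
    field_simp
  rw [hinv]
  have := Filter.Tendsto.pow (isZeroAtImInfty_etaForm hr F) 24
  rwa [zero_pow (by omega)] at this

/-- The rational matrix `(24 0; 0 1)`. -/
noncomputable def dilation24 : GL (Fin 2) ℚ :=
  Matrix.GeneralLinearGroup.mkOfDetNeZero !![24, 0; 0, 1] (by simp)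

lemma isCusp_dilation24_smul (γ : SL(2, ℤ)) :
    IsCusp (dilation24.map (Rat.castHom ℝ) • Matrix.SpecialLinearGroup.mapGL ℝ γ •
      (OnePoint.infty : OnePoint ℝ)) 𝒮ℒ := by
  rw [isCusp_SL2Z_iff]
  refine ⟨dilation24 • Matrix.SpecialLinearGroup.mapGL ℚ γ • OnePoint.infty, ?_⟩
  have h : (Matrix.SpecialLinearGroup.mapGL ℚ γ).map (Rat.castHom ℝ) =
      Matrix.SpecialLinearGroup.mapGL ℝ γ := by
    ext i j
    simp
  rw [← Rat.coe_castHom, OnePoint.map_smul, OnePoint.map_smul, OnePoint.map_infty, h]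

lemma dilation24_smul (τ : ℍ) : dilation24.map (Rat.castHom ℝ) • τ = mul24 τ := by
  ext
  rw [coe_smul_of_det_pos (by simp [dilation24, Matrix.GeneralLinearGroup.mkOfDetNeZero,
    Matrix.det_fin_two])]
  simp [num, denom, dilation24, Matrix.GeneralLinearGroup.mkOfDetNeZero, coe_mul24]

/-- The 24th power removes every root of unity and half-integral power: `halfSlash` becomes an
ordinary slash of a level-one form, evaluated at the rational cusp 24γ∞. -/
lemma isZeroAtImInfty_halfSlash_etaForm (hr : 1 ≤ r) (hk : 2 * k + 1 = r + 2 * m)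
    (F : ModularForm 𝒮ℒ (m : ℤ)) (γ : SL(2, ℤ)) :
    IsZeroAtImInfty (halfSlash k (fun τ => etaForm r F (mul24 τ)) γ) := by
  have h := isZeroAt_etaForm_pow hr F (isCusp_dilation24_smul γ)
  rw [OnePoint.IsZeroAt.smul_iff, OnePoint.IsZeroAt.smul_iff, OnePoint.isZeroAt_infty_iff] at h
  have hdet : (0 : ℝ) < (dilation24.map (Rat.castHom ℝ)).det.val := by
    simp [dilation24, Matrix.GeneralLinearGroup.mkOfDetNeZero, Matrix.det_fin_two]
  have hdetv : (dilation24.map (Rat.castHom ℝ)).det.val = 24 := by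
    simp [dilation24, Matrix.GeneralLinearGroup.mkOfDetNeZero, Matrix.det_fin_two]
  -- The power of 24 is the determinant normalisation of the slash action.
  have key (τ : ℍ) : ((((fun w => etaForm r F w ^ 24) ∣[((12 * (r + 2 * m) : ℕ) : ℤ)]
      dilation24.map (Rat.castHom ℝ)) ∣[((12 * (r + 2 * m) : ℕ) : ℤ)]
      Matrix.SpecialLinearGroup.mapGL ℝ γ) τ) = 24 ^ (((12 * (r + 2 * m) : ℕ) : ℤ) - 1) *
      halfSlash k (fun τ => etaForm r F (mul24 τ)) γ τ ^ 24 := by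
    have hne : ((γ 1 0 : ℤ) * (τ : ℂ) + (γ 1 1 : ℤ)) ≠ 0 := by
      rw [← ModularGroup.denom_apply]
      exact denom_ne_zero _ _
    have hs : ((((γ 1 0 : ℤ) * (τ : ℂ) + (γ 1 1 : ℤ)) ^ (1 / 2 : ℂ)) ^
        (-(2 * (k : ℤ) + 1))) ^ 24 =
        ((γ 1 0 : ℤ) * (τ : ℂ) + (γ 1 1 : ℤ)) ^ (-((12 * (r + 2 * m) : ℕ) : ℤ)) := by
      have h2 : (((γ 1 0 : ℤ) * (τ : ℂ) + (γ 1 1 : ℤ)) ^ (1 / 2 : ℂ)) ^ (2 : ℤ) =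
          (γ 1 0 : ℤ) * (τ : ℂ) + (γ 1 1 : ℤ) := by
        rw [zpow_ofNat, ← Complex.cpow_nat_mul]
        simp
      rw [← h2, ← zpow_natCast, ← zpow_mul, ← zpow_mul, h2, ← hk]
      congr 1
      push_cast
      ring
    have hsl : ((((fun w => etaForm r F w ^ 24) ∣[((12 * (r + 2 * m) : ℕ) : ℤ)]
      dilation24.map (Rat.castHom ℝ)) ∣[((12 * (r + 2 * m) : ℕ) : ℤ)]
      Matrix.SpecialLinearGroup.mapGL ℝ γ) τ) = ((fun w => etaForm r F w ^ 24)
        ∣[((12 * (r + 2 * m) : ℕ) : ℤ)] dilation24.map (Rat.castHom ℝ)) (γ • τ) *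
        ((γ 1 0 : ℤ) * (τ : ℂ) + (γ 1 1 : ℤ)) ^ (-((12 * (r + 2 * m) : ℕ) : ℤ)) := by
      rw [← ModularGroup.denom_apply]
      exact SL_slash_apply _ γ τ
    rw [hsl, ← hs, slash_def, halfSlash]
    simp only [dilation24_smul, hdetv, σ]
    have hden (z : ℍ) : denom (dilation24.map (Rat.castHom ℝ)) z = 1 := by
      simp [denom, dilation24, Matrix.GeneralLinearGroup.mkOfDetNeZero]
    simp only [hden, one_zpow, mul_one, Nat.abs_ofNat]
    simp
    ring
  rw [IsZeroAtImInfty, ZeroAtFilter, Metric.tendsto_nhds] at h ⊢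
  intro ε hε
  filter_upwards [h (24 ^ (((12 * (r + 2 * m) : ℕ) : ℤ) - 1) * ε ^ 24) (by positivity)] with τ hτ
  rw [key, dist_zero_right, norm_mul, norm_zpow, norm_pow, Complex.norm_ofNat] at hτ
  rw [dist_zero_right]
  exact lt_of_pow_lt_pow_left₀ 24 hε.le (lt_of_mul_lt_mul_left hτ (by positivity))

lemma chi12_pow_of_odd {d : ℤ} (hd : IsCoprime d 12) {r : ℕ} (hr : Odd r) :
    (chi12' d) ^ r = chi12' d := by
  rcases emod_twelve_of_isCoprime hd with h | h | h | h <;> rw [chi12'_of_emod h]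
  · rw [show chi12' 1 = 1 by decide, one_pow]
  · rw [show chi12' 5 = -1 by decide, hr.neg_one_pow]
  · rw [show chi12' 7 = -1 by decide, hr.neg_one_pow]
  · rw [show chi12' 11 = 1 by decide, one_pow]

/-- Conjugation by diag(24, 1) carries γ to an integral matrix, since 24 divides its lower left
entry. -/
lemma modularForm_mul24_smul {n : ℤ} (F : ModularForm 𝒮ℒ n) {γ : SL(2, ℤ)}
    (hγ : γ ∈ CongruenceSubgroup.Gamma0 576) (τ : ℍ) :
    F (mul24 (γ • τ)) = ((γ 1 0 : ℤ) * (τ : ℂ) + (γ 1 1 : ℤ)) ^ n * F (mul24 τ) := by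
  have hdet := det_fin_two_eq_one γ
  rw [CongruenceSubgroup.Gamma0_mem, ZMod.intCast_zmod_eq_zero_iff_dvd] at hγ
  obtain ⟨c, hc⟩ := hγ
  let γ' : SL(2, ℤ) := ⟨!![γ 0 0, 24 * γ 0 1; 24 * c, γ 1 1], by
    rw [Matrix.det_fin_two_of]
    push_cast at hc
    linear_combination hdet + γ 0 1 * hc⟩
  have h1 : mul24 (γ • τ) = γ' • mul24 τ := by
    ext
    rw [coe_mul24, coe_SL_smul, coe_SL_smul, coe_mul24, hc]
    simp [γ']
    ring_nf
  rw [h1, modularForm_SL_smul F, coe_mul24, hc]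
  congr 2
  simp [γ']
  ring

lemma isThetaInvariant_etaForm (hr : Odd r) (hm : Even m) (hk : 2 * k + 1 = r + 2 * m)
    (F : ModularForm 𝒮ℒ (m : ℤ)) :
    IsThetaInvariant k 576 chi12 (fun τ => etaForm r F (mul24 τ)) := by
  intro γ hγ τ
  obtain ⟨κ, h4, hθ, hη⟩ := exists_theta_factor hγ τ
  have hcop : IsCoprime (γ 1 1) 12 := by
    have hdet := det_fin_two_eq_one γ
    rw [CongruenceSubgroup.Gamma0_mem, ZMod.intCast_zmod_eq_zero_iff_dvd] at hγ
    obtain ⟨c, hc⟩ := hγ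
    refine ⟨γ 0 0, -48 * γ 0 1 * c, ?_⟩
    push_cast at hc
    linear_combination hdet + γ 0 1 * hc
  have hχ := chi12_intCast (isCoprime_576_of_twelve hcop)
  have hχr : chi12 ((γ 1 1 : ℤ) : ZMod 576) ^ r = chi12 ((γ 1 1 : ℤ) : ZMod 576) := by
    rw [hχ]
    exact_mod_cast chi12_pow_of_odd hcop hr
  obtain ⟨n, rfl⟩ := hm
  -- This is where the weight must be even: only `κ ^ 4` is known.
  have hκ : κ ^ (2 * (n + n)) = ((γ 1 0 : ℤ) * (τ : ℂ) + (γ 1 1 : ℤ)) ^ (n + n) := by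
    rw [show 2 * (n + n) = 4 * n by ring, pow_mul, h4, ← pow_mul]
    congr 1
    ring
  simp only [etaForm]
  rw [hη, modularForm_mul24_smul F hγ, hθ, zpow_natCast, ← hκ, mul_pow, mul_pow, hχr, mul_pow, hk,
    pow_add κ]
  ring

lemma mdifferentiable_comp_mul24 {f : ℍ → ℂ} (hf : MDifferentiable 𝓘(ℂ) 𝓘(ℂ) f) :
    MDifferentiable 𝓘(ℂ) 𝓘(ℂ) (fun τ => f (mul24 τ)) := by
  rw [UpperHalfPlane.mdifferentiable_iff] at hf ⊢
  have hmap : Set.MapsTo (fun z : ℂ => 24 * z) {z | 0 < z.im} {z | 0 < z.im} := by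
    intro z hz
    simpa using hz
  refine (hf.comp (g := f ∘ ofComplex) (f := fun z : ℂ => 24 * z)
    (by fun_prop) hmap).congr fun z hz => ?_
  have hz' : 0 < (24 * z).im := hmap hz
  simp only [Function.comp_apply]
  rw [ofComplex_apply_of_im_pos hz, ofComplex_apply_of_im_pos hz']
  rfl

theorem etaSpace_le_cuspForms (hr₁ : 1 ≤ r) (hr : Odd r) (hm : Even m)
    (hk : 2 * k + 1 = r + 2 * m) : etaSpace r m ≤ cuspForms k 576 chi12 := by
  rintro g ⟨F, hF⟩
  obtain rfl : g = fun τ => etaForm r F (mul24 τ) := funext hF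
  exact ⟨mdifferentiable_comp_mul24 (mdifferentiable_etaForm F),
    isThetaInvariant_etaForm hr hm hk F,
    isZeroAtImInfty_halfSlash_etaForm hr₁ hk F⟩

end EtaForm

end HalfIntegral

namespace HalfIntegral

open Complex hiding eta
open Filter Topology ModularForm

/-! ### T(ℓ²) as a finite combination of translates and dilations -/

section HeckeSeries

variable {ℓ : ℕ} [Fact ℓ.Prime] {a : ℕ → ℂ} {h : ℂ → ℂ}

/-- `h(w) = ∑ a(n) exp(2πi n w / 24)` on the upper half-plane. -/
def HasExpansion24 (a : ℕ → ℂ) (h : ℂ → ℂ) : Prop :=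
  ∀ w : ℂ, 0 < w.im → HasSum (fun n : ℕ => a n * cexp (2 * Real.pi * I * n * (w / 24))) (h w)

/-- The sum of `h((w + 24b)/ℓ²)` over `b` modulo `ℓ²`. -/
noncomputable def sumU (ℓ : ℕ) [Fact ℓ.Prime] (h : ℂ → ℂ) (w : ℂ) : ℂ :=
  ∑ b : ZMod (ℓ ^ 2), h ((w + 24 * (b.val : ℂ)) / ℓ ^ 2)

/-- The sum of `(u/ℓ) h(w + 24u/ℓ)` over `u` modulo `ℓ`. -/
noncomputable def sumV (ℓ : ℕ) [Fact ℓ.Prime] (h : ℂ → ℂ) (w : ℂ) : ℂ :=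
  ∑ u : ZMod ℓ, legendreChar ℓ u * h (w + 24 * (u.val : ℂ) / ℓ)

lemma im_add_div_sq {w : ℂ} (hw : 0 < w.im) (n : ℤ) :
    0 < ((w + 24 * (n : ℂ)) / ℓ ^ 2).im := by
  have hℓ : (0 : ℝ) < ℓ := by exact_mod_cast (Fact.out : ℓ.Prime).pos
  have e : (w + 24 * (n : ℂ)) / ℓ ^ 2 = ((1 / ℓ ^ 2 : ℝ) : ℂ) * (w + ((24 * n : ℝ) : ℂ)) := by
    push_cast
    ring
  rw [e, Complex.im_ofReal_mul, Complex.add_im, Complex.ofReal_im, add_zero]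
  positivity

lemma im_add_div {ℓ : ℕ} {w : ℂ} (hw : 0 < w.im) (n : ℤ) : 0 < (w + 24 * (n : ℂ) / ℓ).im := by
  have e : w + 24 * (n : ℂ) / ℓ = w + ((24 * n / ℓ : ℝ) : ℂ) := by
    push_cast
    ring
  rw [e, Complex.add_im, Complex.ofReal_im, add_zero]
  exact hw

lemma im_sq_mul {w : ℂ} (hw : 0 < w.im) : 0 < ((ℓ : ℂ) ^ 2 * w).im :=
  haveI : NeZero ℓ := ⟨(Fact.out : ℓ.Prime).ne_zero⟩
  im_natCast_sq_mul_pos ℓ hw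

/-- Orthogonality of additive characters modulo ℓ² keeps only the exponents divisible by ℓ². -/
lemma HasExpansion24.hasSum_sumU (hah : HasExpansion24 a h) {w : ℂ} (hw : 0 < w.im) :
    HasSum (fun n : ℕ => a (ℓ ^ 2 * n) * cexp (2 * Real.pi * I * n * (w / 24)))
      (((ℓ : ℂ) ^ 2)⁻¹ * sumU ℓ h w) := by
  have hℓ0 : (ℓ : ℂ) ≠ 0 := by exact_mod_cast (Fact.out : ℓ.Prime).ne_zero
  have h1 := hasSum_sum (s := Finset.univ) fun (b : ZMod (ℓ ^ 2)) _ =>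
    hah ((w + 24 * (b.val : ℂ)) / ℓ ^ 2)
      (by simpa only [Int.cast_natCast] using im_add_div_sq (ℓ := ℓ) hw (b.val : ℤ))
  have h2 := h1.mul_left ((ℓ : ℂ) ^ 2)⁻¹
  have hinj : Function.Injective fun n : ℕ => ℓ ^ 2 * n :=
    fun x y hxy => Nat.eq_of_mul_eq_mul_left (pow_pos (Fact.out : ℓ.Prime).pos 2) hxy
  have key (n : ℕ) : ((ℓ : ℂ) ^ 2)⁻¹ * ∑ b : ZMod (ℓ ^ 2), a n * cexp (2 * Real.pi * I * n *
      ((w + 24 * (b.val : ℂ)) / ℓ ^ 2 / 24)) =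
      if ℓ ^ 2 ∣ n then a n * cexp (2 * Real.pi * I * n * (w / 24 / ℓ ^ 2)) else 0 := by
    have e (b : ZMod (ℓ ^ 2)) : a n * cexp (2 * Real.pi * I * n *
      ((w + 24 * (b.val : ℂ)) / ℓ ^ 2 / 24)) = a n * cexp (2 * Real.pi * I * n *
        (w / 24 / ℓ ^ 2)) * ZMod.stdAddChar (b * (n : ZMod (ℓ ^ 2))) := by
      have := ZMod.stdAddChar_coe (N := ℓ ^ 2) (b.val * n)
      push_cast at this
      rw [ZMod.natCast_zmod_val] at this
      rw [this, mul_assoc (a n), ← Complex.exp_add]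
      congr 2
      field_simp
    rw [Finset.sum_congr rfl fun b _ => e b, ← Finset.mul_sum,
      AddChar.sum_mulShift _ (ZMod.isPrimitive_stdAddChar (ℓ ^ 2)), ZMod.card]
    by_cases hn : ℓ ^ 2 ∣ n
    · rw [if_pos hn, if_pos ((ZMod.natCast_eq_zero_iff _ _).mpr hn)]
      push_cast
      field_simp
    · rw [if_neg hn, if_neg (fun h => hn ((ZMod.natCast_eq_zero_iff _ _).mp h))]
      simp
  have h3 := h2.congr_fun fun n => (key n).symm
  have h4 := (hinj.hasSum_iff (fun n hn => if_neg fun ⟨j, hj⟩ => hn ⟨j, hj.symm⟩)).mpr h3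
  refine h4.congr_fun fun n => ?_
  rw [Function.comp_apply, if_pos (dvd_mul_right _ _)]
  congr 2
  push_cast
  field_simp

/-- The Legendre symbol is its own finite Fourier transform up to the Gauss sum, so the twist of the
coefficients is a sum of translates. -/
lemma HasExpansion24.hasSum_sumV (hℓ : ℓ ≠ 2) (hah : HasExpansion24 a h) {w : ℂ}
    (hw : 0 < w.im) :
    HasSum (fun n : ℕ => legendreChar ℓ n * a n * cexp (2 * Real.pi * I * n * (w / 24)))
      ((legendreGaussSum ℓ)⁻¹ * sumV ℓ h w) := by
  have hℓ0 : (ℓ : ℂ) ≠ 0 := by exact_mod_cast (Fact.out : ℓ.Prime).ne_zero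
  have hg : legendreGaussSum ℓ ≠ 0 := by
    intro h0
    have := legendreGaussSum_sq hℓ
    rw [h0, zero_pow two_ne_zero, eq_comm, mul_eq_zero] at this
    refine this.elim (fun h1 => ?_) hℓ0
    exact (isUnit_one.neg.map (legendreChar ℓ)).ne_zero h1
  have h1 := hasSum_sum (s := Finset.univ) fun (u : ZMod ℓ) _ =>
    (hah (w + 24 * (u.val : ℂ) / ℓ)
      (by simpa only [Int.cast_natCast] using im_add_div (ℓ := ℓ) hw (u.val : ℤ))).mul_left (legendreChar ℓ u)
  have h2 := h1.mul_left (legendreGaussSum ℓ)⁻¹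
  refine h2.congr_fun fun n => ?_
  have e (u : ZMod ℓ) : legendreChar ℓ u * (a n * cexp (2 * Real.pi * I * n *
      ((w + 24 * (u.val : ℂ) / ℓ) / 24))) = a n * cexp (2 * Real.pi * I * n *
        (w / 24)) * (legendreChar ℓ u * ZMod.stdAddChar ((n : ZMod ℓ) * u)) := by
    have := ZMod.stdAddChar_coe (N := ℓ) (n * u.val)
    push_cast at this
    rw [ZMod.natCast_zmod_val] at this
    rw [this, show ∀ p q r s : ℂ, p * q * (r * s) = r * (p * (q * s)) by intros; ring,
      ← Complex.exp_add]
    congr 3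
    field_simp
  rw [Finset.sum_congr rfl fun u _ => e u, ← Finset.mul_sum, sum_legendreChar_mul_stdAddChar hℓ]
  field_simp

lemma HasExpansion24.hasSum_sq_mul (hah : HasExpansion24 a h) {w : ℂ} (hw : 0 < w.im) :
    HasSum (fun n : ℕ => (if ℓ ^ 2 ∣ n then a (n / ℓ ^ 2) else 0) *
      cexp (2 * Real.pi * I * n * (w / 24))) (h (ℓ ^ 2 * w)) := by
  have hpos := pow_pos (Fact.out : ℓ.Prime).pos 2
  have hinj : Function.Injective fun n : ℕ => ℓ ^ 2 * n :=
    fun x y hxy => Nat.eq_of_mul_eq_mul_left hpos hxy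
  refine (hinj.hasSum_iff (fun n hn => ?_)).mp ((hah _ (im_sq_mul hw)).congr_fun fun n => ?_)
  · rw [if_neg fun ⟨j, hj⟩ => hn ⟨j, hj.symm⟩, zero_mul]
  · rw [Function.comp_apply, if_pos (dvd_mul_right _ _), Nat.mul_div_cancel_left _ hpos]
    congr 2
    push_cast
    ring

/-- The Hecke operator as a combination of `U`, `V` and dilation by `ℓ²`. -/
noncomputable def heckeSum (k ℓ : ℕ) [Fact ℓ.Prime] (h : ℂ → ℂ) (w : ℂ) : ℂ :=
  ((ℓ : ℂ) ^ 2)⁻¹ * sumU ℓ h w +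
    chi12' ℓ * legendreChar ℓ (-1) ^ k * (ℓ : ℂ) ^ ((k : ℤ) - 1) * (legendreGaussSum ℓ)⁻¹ *
      sumV ℓ h w +
    (ℓ : ℂ) ^ (2 * (k : ℤ) - 1) * h (ℓ ^ 2 * w)

lemma isCoprime_prime_twelve (hℓ : 3 < ℓ) : IsCoprime (ℓ : ℤ) 12 := by
  have hp : ℓ.Prime := Fact.out
  have : Nat.Coprime ℓ 12 := by
    rw [hp.coprime_iff_not_dvd]
    intro h
    rw [show 12 = 2 * 2 * 3 by norm_num, hp.dvd_mul, hp.dvd_mul] at h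
    rcases h with (h | h) | h <;> have := Nat.le_of_dvd (by norm_num) h <;> omega
  exact_mod_cast Nat.isCoprime_iff_coprime.mpr this

lemma chi12'_sq {n : ℤ} (hn : IsCoprime n 12) : chi12' n ^ 2 = 1 := by
  rcases emod_twelve_of_isCoprime hn with h | h | h | h <;> rw [chi12'_of_emod h] <;> decide

lemma chi12_prime (hℓ : 3 < ℓ) : chi12 (ℓ : ZMod 576) = chi12' ℓ := by
  have := chi12_intCast (isCoprime_576_of_twelve (isCoprime_prime_twelve hℓ))
  simpa using this

lemma chi12_prime_sq (hℓ : 3 < ℓ) : chi12 ((ℓ ^ 2 : ℕ) : ZMod 576) = 1 := by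
  have := chi12'_sq (isCoprime_prime_twelve hℓ)
  rw [Nat.cast_pow, map_pow, chi12_prime hℓ]
  exact_mod_cast this

lemma hasSum_heckeCoeff (k : ℕ) (hℓ : 3 < ℓ) {g : ℍ → ℂ}
    (hah : HasExpansion24 (qCoeff g) h) {w : ℂ} (hw : 0 < w.im) :
    HasSum (fun n : ℕ => heckeCoeff k chi12 ℓ g n * cexp (2 * Real.pi * I * n * (w / 24)))
      (heckeSum k ℓ h w) := by
  have h1 := hah.hasSum_sumU (ℓ := ℓ) hw
  have h2 := (hah.hasSum_sumV (ℓ := ℓ) (by omega) hw).mul_left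
    (chi12' ℓ * legendreChar ℓ (-1) ^ k * (ℓ : ℂ) ^ ((k : ℤ) - 1))
  have h3 := (hah.hasSum_sq_mul (ℓ := ℓ) hw).mul_left ((ℓ : ℂ) ^ (2 * (k : ℤ) - 1))
  have h4 := (h1.add h2).add h3
  rw [heckeSum, mul_assoc _ (legendreGaussSum ℓ)⁻¹]
  refine h4.congr_fun fun n => ?_
  have hleg : (legendreSym ℓ ((-1) ^ k * (n : ℤ)) : ℂ) =
      legendreChar ℓ (-1) ^ k * legendreChar ℓ n := by
    rw [← legendreChar_intCast]
    push_cast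
    rw [map_mul, map_pow]
  rw [heckeCoeff, hleg, chi12_prime hℓ, chi12_prime_sq hℓ]
  ring

end HeckeSeries

end HalfIntegral

namespace HalfIntegral

open Complex hiding eta
open Filter Topology ModularForm

/-! ### T(ℓ²) commutes with the inversion -/

section HeckeInversion

/-- The transformation laws of `η^r F`, with `F` of level one and weight `2n`, that enter in the
proof that the Hecke operator commutes with `w ↦ -1/w`. -/
structure EtaTransforms (r n : ℕ) (h : ℂ → ℂ) : Prop where
  add_int : ∀ w : ℂ, 0 < w.im → ∀ j : ℤ, h (w + 24 * j) = h w
  gaussSum : ∀ (c : ℕ) [NeZero c] (A B D : ℤ), 24 * A * (24 * D) - B * c = 1 →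
    ∀ w : ℂ, 0 < w.im → h ((24 * A * w + B) / (c * w + 24 * D)) =
      chi12' c * (-1) ^ n * (quadGaussSum c (A : ZMod c) / √c) ^ r *
        sqrtNegI (c * w + 24 * D) ^ (r + 4 * n) * h w

lemma im_pos_of_coe_eq {γ : SL(2, ℤ)} {w z : ℂ} (hw : 0 < w.im)
    (hz : z = ((γ 0 0 : ℤ) * w + (γ 0 1 : ℤ)) / ((γ 1 0 : ℤ) * w + (γ 1 1 : ℤ))) :
    ofComplex z = γ • (⟨w, hw⟩ : ℍ) ∧ 0 < z.im := by
  have h := coe_SL_smul γ ⟨w, hw⟩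
  have hz' : z = ((γ • (⟨w, hw⟩ : ℍ) : ℍ) : ℂ) := by rw [hz, h]
  rw [hz', ofComplex_apply]
  exact ⟨rfl, (γ • (⟨w, hw⟩ : ℍ)).im_pos⟩

lemma eta_add_intCast (w : ℂ) (j : ℤ) :
    eta (w + j) = cexp (2 * Real.pi * I * j / 24) * eta w := by
  have h1 : Function.Periodic.qParam 1 (w + j) = Function.Periodic.qParam 1 w := by
    rw [Function.Periodic.qParam, Function.Periodic.qParam,
      show 2 * Real.pi * I * (w + j) / ((1 : ℝ) : ℂ) = 2 * Real.pi * I * w / ((1 : ℝ) : ℂ) +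
        j * (2 * Real.pi * I) by push_cast; ring, Complex.exp_add,
      Complex.exp_int_mul_two_pi_mul_I, mul_one]
  have h24 : Function.Periodic.qParam 24 (w + j) =
      cexp (2 * Real.pi * I * j / 24) * Function.Periodic.qParam 24 w := by
    rw [Function.Periodic.qParam, Function.Periodic.qParam, ← Complex.exp_add]
    congr 1
    push_cast
    ring
  simp only [eta, eta_q, h1, h24]
  ring

variable {r m n k : ℕ}

lemma etaForm_ofComplex_add_intCast (F : ModularForm 𝒮ℒ (m : ℤ)) {w : ℂ} (hw : 0 < w.im) (j : ℤ) :
    etaForm r F (ofComplex (w + j)) =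
      cexp (2 * Real.pi * I * j / 24) ^ r * etaForm r F (ofComplex w) := by
  have hT := im_pos_of_coe_eq (γ := ModularGroup.T ^ j) (z := w + j) hw (by
    simp [ModularGroup.coe_T_zpow])
  rw [etaForm, etaForm, hT.1, modularForm_SL_smul F, ← hT.1, ofComplex_apply_of_im_pos hT.2,
    ofComplex_apply_of_im_pos hw, UpperHalfPlane.coe_mk, UpperHalfPlane.coe_mk, eta_add_intCast]
  simp [ModularGroup.coe_T_zpow]
  ring

/-- It lets the integral weight 2n of F join the weight r/2 of η^r in one power of `sqrtNegI`, at
the cost of the sign (-1)^n. -/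
lemma sqrtNegI_pow_eq (W : ℂ) (n : ℕ) : sqrtNegI W ^ (4 * n) = (-1) ^ n * W ^ (2 * n) := by
  rw [pow_mul, sqrtNegI_pow_four, pow_mul, ← mul_pow, neg_one_mul]

lemma etaTransforms_etaForm (hr : Odd r) (F : ModularForm 𝒮ℒ ((n + n : ℕ) : ℤ)) :
    EtaTransforms r n (fun w => etaForm r F (ofComplex w)) where
  add_int w hw j := by
    have := etaForm_ofComplex_add_intCast (r := r) F hw (24 * j)
    push_cast at this
    rw [this, show 2 * Real.pi * I * (24 * (j : ℂ)) / 24 = j * (2 * Real.pi * I) by ring,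
      Complex.exp_int_mul_two_pi_mul_I, one_pow, one_mul]
  gaussSum c _ A B D hdet w hw := by
    have hcop : IsCoprime (c : ℤ) 12 := ⟨-B, 48 * A * D, by linarith⟩
    have hχ : (chi12' c : ℂ) ^ r = chi12' c := by exact_mod_cast chi12_pow_of_odd hcop hr
    let γ : SL(2, ℤ) := ⟨!![24 * A, B; c, 24 * D], by rw [Matrix.det_fin_two_of]; exact hdet⟩
    obtain ⟨h1, h2⟩ := im_pos_of_coe_eq (γ := γ) (z := (24 * A * w + B) / (c * w + 24 * D)) hw
      (by simp [γ])
    have hη := eta_gaussSum hdet hw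
    simp only [etaForm]
    rw [h1, modularForm_SL_smul F, ← h1, ofComplex_apply_of_im_pos h2, UpperHalfPlane.coe_mk, hη,
      ofComplex_apply_of_im_pos hw, mul_pow, mul_pow, mul_pow, hχ, pow_add, sqrtNegI_pow_eq]
    have hγ : ((γ 1 0 : ℤ) : ℂ) * ((⟨w, hw⟩ : ℍ) : ℂ) + ((γ 1 1 : ℤ) : ℂ) = c * w + 24 * D := by
      simp [γ]
    have hone : ((-1 : ℂ)) ^ n * (-1) ^ n = 1 := by rw [← mul_pow]; simp
    rw [hγ, zpow_natCast, UpperHalfPlane.coe_mk]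
    generalize (c : ℂ) * w + 24 * D = W
    linear_combination (-(chi12' c * (quadGaussSum c (A : ZMod c) / √c) ^ r * sqrtNegI W ^ r *
      W ^ (2 * n) * eta w ^ r * F ⟨w, hw⟩)) * hone

variable {ℓ : ℕ} [Fact ℓ.Prime] {h : ℂ → ℂ}

lemma EtaTransforms.neg_inv (hh : EtaTransforms r n h) {w : ℂ} (hw : 0 < w.im) :
    h (-1 / w) = (-1) ^ n * sqrtNegI w ^ (r + 4 * n) * h w := by
  -- With c = 1 and A = D = 0 the matrix is S itself, and its Gauss sum is 1.
  have := hh.gaussSum 1 0 (-1) 0 (by norm_num) w hw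
  have hG : quadGaussSum 1 0 = 1 := by
    rw [quadGaussSum, Fintype.sum_unique]
    simp
  have hχ : chi12' 1 = 1 := by decide
  simpa [hG, hχ] using this

lemma EtaTransforms.congr_sq (hh : EtaTransforms r n h) {w : ℂ} (hw : 0 < w.im) {i j : ℤ}
    (hij : (i : ZMod (ℓ ^ 2)) = j) :
    h ((w + 24 * (i : ℂ)) / ℓ ^ 2) = h ((w + 24 * (j : ℂ)) / ℓ ^ 2) := by
  have hℓ0 : (ℓ : ℂ) ≠ 0 := by exact_mod_cast (Fact.out : ℓ.Prime).ne_zero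
  rw [ZMod.intCast_eq_intCast_iff_dvd_sub] at hij
  obtain ⟨d, hd⟩ := hij
  have hd' : (j : ℂ) - i = ℓ ^ 2 * d := by exact_mod_cast hd
  rw [← hh.add_int _ (im_add_div_sq hw i) d]
  congr 1
  field_simp
  linear_combination (-24 : ℂ) * hd'

/-- The multiples of `ℓ` in `sumU`, apart from zero. -/
noncomputable def sumU₁ (ℓ : ℕ) [Fact ℓ.Prime] (h : ℂ → ℂ) (w : ℂ) : ℂ :=
  ∑ v : ZMod ℓ, legendreChar ℓ v ^ 2 * h ((w + 24 * ℓ * (v.val : ℂ)) / ℓ ^ 2)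

/-- The units in `sumU`. -/
noncomputable def sumU₂ (ℓ : ℕ) [Fact ℓ.Prime] (h : ℂ → ℂ) (w : ℂ) : ℂ :=
  ∑ b : (ZMod (ℓ ^ 2))ˣ, h ((w + 24 * ((b : ZMod (ℓ ^ 2)).val : ℂ)) / ℓ ^ 2)

lemma legendreChar_sq_eq (v : ZMod ℓ) : legendreChar ℓ v ^ 2 = if v = 0 then 0 else 1 := by
  split_ifs with hv
  · rw [hv, MulChar.map_zero, zero_pow two_ne_zero]
  · have : quadraticChar (ZMod ℓ) v ^ 2 = 1 := quadraticChar_sq_one hv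
    have : ((quadraticChar (ZMod ℓ) v : ℤ) : ℂ) ^ 2 = 1 := by exact_mod_cast this
    exact this

lemma EtaTransforms.sumU_eq (hh : EtaTransforms r n h) {w : ℂ} (hw : 0 < w.im) :
    sumU ℓ h w = h (w / ℓ ^ 2) + sumU₁ ℓ h w + sumU₂ ℓ h w := by
  have e (v : ZMod ℓ) : h ((w + 24 * ((((ℓ * v.val : ℕ) : ZMod (ℓ ^ 2))).val : ℂ)) / ℓ ^ 2) =
      h ((w + 24 * ℓ * (v.val : ℂ)) / ℓ ^ 2) := by
    have := hh.congr_sq (ℓ := ℓ) hw (i := (((ℓ * v.val : ℕ) : ZMod (ℓ ^ 2))).val)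
      (j := (ℓ * v.val : ℕ)) (by rw [Int.cast_natCast, Int.cast_natCast, ZMod.natCast_zmod_val])
    rw [Int.cast_natCast, Int.cast_natCast] at this
    rw [this]
    push_cast
    ring_nf
  rw [sumU, sum_zmod_sq, add_comm, sumU₂, Finset.sum_congr rfl fun v _ => e v, sumU₁,
    ← Finset.add_sum_erase _ _ (Finset.mem_univ (0 : ZMod ℓ)),
    ← Finset.add_sum_erase Finset.univ (fun v => legendreChar ℓ v ^ 2 *
      h ((w + 24 * ℓ * (v.val : ℂ)) / ℓ ^ 2)) (Finset.mem_univ (0 : ZMod ℓ))]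
  congr 1
  -- The squared Legendre symbol removes v = 0, which is the separate term h(w/ℓ²).
  rw [legendreChar_sq_eq, if_pos rfl, zero_mul, zero_add]
  congr 1
  · simp
  · refine Finset.sum_congr rfl fun v hv => ?_
    rw [legendreChar_sq_eq, if_neg (Finset.ne_of_mem_erase hv), one_mul]

lemma ofNat_576_ne_zero (hℓ : 3 < ℓ) : (576 : ZMod ℓ) ≠ 0 := by
  have h := isCoprime_576_of_twelve (isCoprime_prime_twelve hℓ)
  intro h0
  have : ((576 : ℤ) : ZMod ℓ) = 0 := by exact_mod_cast h0
  rw [ZMod.intCast_zmod_eq_zero_iff_dvd] at this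
  have := h.isUnit_of_dvd' dvd_rfl this
  rw [Int.isUnit_iff] at this
  omega

/-- The involution `v ↦ -1/(576 v)` of `ZMod ℓ`. -/
def negInv576 (ℓ : ℕ) [Fact ℓ.Prime] (v : ZMod ℓ) : ZMod ℓ := -(576 * v)⁻¹

lemma negInv576_involutive (hℓ : 3 < ℓ) : Function.Involutive (negInv576 ℓ) := by
  intro v
  have := ofNat_576_ne_zero hℓ
  rcases eq_or_ne v 0 with rfl | hv
  · simp [negInv576]
  · rw [negInv576, negInv576]
    field_simp

lemma legendreChar_negInv576 (hℓ : 3 < ℓ) (v : ZMod ℓ) :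
    legendreChar ℓ (negInv576 ℓ v) = legendreChar ℓ (-1) * legendreChar ℓ v := by
  have h576 := ofNat_576_ne_zero hℓ
  rcases eq_or_ne v 0 with rfl | hv
  · simp [negInv576, MulChar.map_zero]
  · have h24 : (24 : ZMod ℓ) ≠ 0 := by
      intro h0
      apply h576
      rw [show (576 : ZMod ℓ) = 24 * 24 by norm_num, h0, zero_mul]
    have e : negInv576 ℓ v = -1 * v * ((24 * v)⁻¹) ^ 2 := by
      rw [negInv576, show (576 : ZMod ℓ) = 24 * 24 by norm_num]
      field_simp
    rw [e, map_mul, map_mul, map_pow, legendreChar_sq_eq, if_neg (by simp [h24, hv]), mul_one]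

lemma exists_det_eq {q : ℕ} {a d : ℕ} (h : (576 * a * d + 1 : ZMod q) = 0) :
    ∃ B : ℤ, 24 * (a : ℤ) * (24 * (-(d : ℤ))) - B * q = 1 := by
  have : ((576 * a * d + 1 : ℤ) : ZMod q) = 0 := by exact_mod_cast h
  rw [ZMod.intCast_zmod_eq_zero_iff_dvd] at this
  obtain ⟨B, hB⟩ := this
  exact ⟨-B, by linarith⟩

lemma mul_negInv576 (hℓ : 3 < ℓ) {v : ZMod ℓ} (hv : v ≠ 0) :
    (576 * (v.val : ZMod ℓ) * ((negInv576 ℓ v).val : ZMod ℓ) + 1 : ZMod ℓ) = 0 := by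
  have h576 := ofNat_576_ne_zero hℓ
  rw [ZMod.natCast_zmod_val, ZMod.natCast_zmod_val, negInv576]
  field_simp
  ring

lemma sqrt_natCast_pow_two (ℓ : ℕ) : ((√(ℓ : ℝ) : ℝ) : ℂ) ^ 2 = ℓ := by
  rw [← Complex.ofReal_pow, Real.sq_sqrt (Nat.cast_nonneg ℓ)]
  simp

lemma legendreGaussSum_pow_four (hℓ : ℓ ≠ 2) : legendreGaussSum ℓ ^ 4 = (ℓ : ℂ) ^ 2 := by
  rw [show 4 = 2 * 2 from rfl, pow_mul, legendreGaussSum_sq hℓ, mul_pow, legendreChar_sq_eq,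
    if_neg (by simp), one_mul]

/-- The powers of the Gauss sum and of `√ℓ` in the transformation laws, for a unit `v`. -/
lemma gaussSum_div_sqrt_pow (hℓ : ℓ ≠ 2) (hr : Odd r) {v : ZMod ℓ} (hv : v ≠ 0) (n : ℕ) :
    (quadGaussSum ℓ v / (√(ℓ : ℝ) : ℝ)) ^ r * ((√(ℓ : ℝ) : ℝ) : ℂ) ^ (r + 4 * n) =
      legendreChar ℓ v * legendreGaussSum ℓ ^ (r + 4 * n) := by
  have hℓ0 : (0 : ℝ) < ℓ := by exact_mod_cast (Fact.out : ℓ.Prime).pos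
  have hs : ((√(ℓ : ℝ) : ℝ) : ℂ) ≠ 0 := by
    rw [Complex.ofReal_ne_zero]
    positivity
  have hleg : legendreChar ℓ v ^ r = legendreChar ℓ v := by
    obtain ⟨j, rfl⟩ := hr
    rw [pow_succ, pow_mul, legendreChar_sq_eq, if_neg hv, one_pow, one_mul]
  -- The Gauss sum and √ℓ have the same fourth power ℓ².
  have h4 : ((√(ℓ : ℝ) : ℝ) : ℂ) ^ (4 * n) = legendreGaussSum ℓ ^ (4 * n) := by
    rw [pow_mul, pow_mul, legendreGaussSum_pow_four hℓ, show 4 = 2 * 2 from rfl, pow_mul _ 2 2,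
      sqrt_natCast_pow_two]
  rw [pow_add, ← mul_assoc, ← mul_pow, div_mul_cancel₀ _ hs, h4, quadGaussSum_prime hℓ hv,
    mul_pow, hleg, pow_add, mul_assoc]

/-- With v' = -1/(576v), the matrix (24v B; ℓ -24v') sends w + 24v'/ℓ to (-1/w + 24ℓv)/ℓ². The odd
power of its Gauss sum supplies the Legendre symbol of the twisted sum. -/
lemma EtaTransforms.sumU₁_neg_inv (hh : EtaTransforms r n h) (hr : Odd r) (hℓ : 3 < ℓ) {w : ℂ}
    (hw : 0 < w.im) :
    sumU₁ ℓ h (-1 / w) = chi12' ℓ * (-1) ^ n * sqrtNegI w ^ (r + 4 * n) *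
      legendreGaussSum ℓ ^ (r + 4 * n) * legendreChar ℓ (-1) * sumV ℓ h w := by
  have hw0 : w ≠ 0 := by rintro rfl; simp at hw
  have hℓ0 : (ℓ : ℂ) ≠ 0 := by exact_mod_cast (Fact.out : ℓ.Prime).ne_zero
  have hℓr : (0 : ℝ) < ℓ := by exact_mod_cast (Fact.out : ℓ.Prime).pos
  have key (v : ZMod ℓ) : legendreChar ℓ v ^ 2 *
      h ((-1 / w + 24 * ℓ * (v.val : ℂ)) / ℓ ^ 2) = chi12' ℓ * (-1) ^ n *
        sqrtNegI w ^ (r + 4 * n) * legendreGaussSum ℓ ^ (r + 4 * n) * legendreChar ℓ (-1) *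
        (legendreChar ℓ (negInv576 ℓ v) * h (w + 24 * ((negInv576 ℓ v).val : ℂ) / ℓ)) := by
    rw [legendreChar_negInv576 hℓ]
    rcases eq_or_ne v 0 with rfl | hv
    · simp [MulChar.map_zero]
    obtain ⟨B, hB⟩ := exists_det_eq (mul_negInv576 hℓ hv)
    have hBC : (24 * (v.val : ℂ) * (24 * (-((negInv576 ℓ v).val : ℂ))) - B * ℓ : ℂ) = 1 := by
      exact_mod_cast hB
    have him : 0 < (w + 24 * ((negInv576 ℓ v).val : ℂ) / ℓ).im := by
      simpa only [Int.cast_natCast] using im_add_div (ℓ := ℓ) hw ((negInv576 ℓ v).val : ℤ)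
    have hG := hh.gaussSum ℓ _ B _ hB _ him
    push_cast at hG
    have e1 : (ℓ : ℂ) * (w + 24 * ((negInv576 ℓ v).val : ℂ) / ℓ) +
        24 * (-((negInv576 ℓ v).val : ℂ)) = ((ℓ : ℝ) : ℂ) * w := by
      push_cast
      field_simp
      ring
    have e2 : (24 * (v.val : ℂ) * (w + 24 * ((negInv576 ℓ v).val : ℂ) / ℓ) + B) /
        (((ℓ : ℝ) : ℂ) * w) = (-1 / w + 24 * ℓ * (v.val : ℂ)) / ℓ ^ 2 := by
      push_cast
      field_simp
      linear_combination -hBC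
    have hsq : legendreChar ℓ (-1) ^ 2 = 1 := by rw [legendreChar_sq_eq, if_neg (by simp)]
    rw [e1, e2, sqrtNegI_ofReal_mul hℓr hw0, mul_pow, ZMod.natCast_zmod_val] at hG
    have hpow := gaussSum_div_sqrt_pow (ℓ := ℓ) (by omega) hr hv n
    rw [hG, legendreChar_sq_eq, if_neg hv]
    linear_combination (chi12' ℓ * (-1) ^ n * sqrtNegI w ^ (r + 4 * n) *
      h (w + 24 * ((negInv576 ℓ v).val : ℂ) / ℓ)) * (hpow - legendreChar ℓ v *
        legendreGaussSum ℓ ^ (r + 4 * n) * hsq)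
  rw [sumU₁, Finset.sum_congr rfl fun v _ => key v, ← Finset.mul_sum, sumV]
  congr 1
  exact Equiv.sum_comp (negInv576_involutive hℓ).toPerm
    (fun u => legendreChar ℓ u * h (w + 24 * (u.val : ℂ) / ℓ))

/-- Matrices of the same kind, now applied at (w + 24ℓu')/ℓ². The Legendre symbol of the Gauss sum
meets the one already present, hence the square in `sumU₁`. -/
lemma EtaTransforms.sumV_neg_inv (hh : EtaTransforms r n h) (hr : Odd r) (hℓ : 3 < ℓ) {w : ℂ}
    (hw : 0 < w.im) :
    sumV ℓ h (-1 / w) = chi12' ℓ * (-1) ^ n * sqrtNegI w ^ (r + 4 * n) *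
      legendreGaussSum ℓ ^ (r + 4 * n) * ((ℓ : ℂ) ^ (r + 4 * n))⁻¹ * sumU₁ ℓ h w := by
  have hw0 : w ≠ 0 := by rintro rfl; simp at hw
  have hℓ0 : (ℓ : ℂ) ≠ 0 := by exact_mod_cast (Fact.out : ℓ.Prime).ne_zero
  have hℓr : (0 : ℝ) < ℓ := by exact_mod_cast (Fact.out : ℓ.Prime).pos
  have hs : ((√(ℓ : ℝ) : ℝ) : ℂ) ≠ 0 := by
    rw [Complex.ofReal_ne_zero]
    positivity
  have key (u : ZMod ℓ) : legendreChar ℓ u * h (-1 / w + 24 * (u.val : ℂ) / ℓ) =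
      chi12' ℓ * (-1) ^ n * sqrtNegI w ^ (r + 4 * n) * legendreGaussSum ℓ ^ (r + 4 * n) *
        ((ℓ : ℂ) ^ (r + 4 * n))⁻¹ * (legendreChar ℓ (negInv576 ℓ u) ^ 2 *
        h ((w + 24 * ℓ * ((negInv576 ℓ u).val : ℂ)) / ℓ ^ 2)) := by
    rw [legendreChar_negInv576 hℓ, mul_pow, legendreChar_sq_eq (-1 : ZMod ℓ),
      if_neg (by simp), one_mul]
    rcases eq_or_ne u 0 with rfl | hu
    · simp [MulChar.map_zero]
    obtain ⟨B, hB⟩ := exists_det_eq (mul_negInv576 hℓ hu)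
    have hBC : (24 * (u.val : ℂ) * (24 * (-((negInv576 ℓ u).val : ℂ))) - B * ℓ : ℂ) = 1 := by
      exact_mod_cast hB
    have him : 0 < ((w + 24 * ℓ * ((negInv576 ℓ u).val : ℂ)) / ℓ ^ 2).im := by
      have := im_add_div_sq (ℓ := ℓ) hw (ℓ * (negInv576 ℓ u).val : ℕ)
      push_cast at this
      rwa [← mul_assoc] at this
    have hG := hh.gaussSum ℓ _ B _ hB _ him
    push_cast at hG
    have e1 : (ℓ : ℂ) * ((w + 24 * ℓ * ((negInv576 ℓ u).val : ℂ)) / ℓ ^ 2) +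
        24 * (-((negInv576 ℓ u).val : ℂ)) = ((1 / ℓ : ℝ) : ℂ) * w := by
      push_cast
      field_simp
      ring
    have e2 : (24 * (u.val : ℂ) * ((w + 24 * ℓ * ((negInv576 ℓ u).val : ℂ)) / ℓ ^ 2) + B) /
        (((1 / ℓ : ℝ) : ℂ) * w) = -1 / w + 24 * (u.val : ℂ) / ℓ := by
      push_cast
      field_simp
      linear_combination (-(ℓ:ℂ)) * hBC
    have e3 : ((√(1 / ℓ : ℝ) : ℝ) : ℂ) ^ (r + 4 * n) =
        ((√(ℓ : ℝ) : ℝ) : ℂ) ^ (r + 4 * n) * ((ℓ : ℂ) ^ (r + 4 * n))⁻¹ := by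
      rw [← inv_pow, ← mul_pow, Real.sqrt_div zero_le_one, Real.sqrt_one]
      congr 1
      rw [← sqrt_natCast_pow_two ℓ]
      push_cast
      field_simp
    rw [e1, e2, sqrtNegI_ofReal_mul (by positivity) hw0, mul_pow, ZMod.natCast_zmod_val, e3] at hG
    have hpow := gaussSum_div_sqrt_pow (ℓ := ℓ) (by omega) hr hu n
    rw [hG]
    linear_combination (chi12' ℓ * (-1) ^ n * sqrtNegI w ^ (r + 4 * n) * legendreChar ℓ u *
      ((ℓ : ℂ) ^ (r + 4 * n))⁻¹ * h ((w + 24 * ℓ * ((negInv576 ℓ u).val : ℂ)) / ℓ ^ 2)) * hpow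
  rw [sumV, Finset.sum_congr rfl fun v _ => key v, ← Finset.mul_sum, sumU₁]
  congr 1
  exact Equiv.sum_comp (negInv576_involutive hℓ).toPerm
    (fun v => legendreChar ℓ v ^ 2 * h ((w + 24 * ℓ * (v.val : ℂ)) / ℓ ^ 2))

/-- The units are permuted by b ↦ -1/(576b), with trivial multipliers: the Gauss sum modulo ℓ² is ℓ
= √(ℓ²), and χ₁₂(ℓ²) = 1. -/
lemma EtaTransforms.sumU₂_neg_inv (hh : EtaTransforms r n h) (hℓ : 3 < ℓ) {w : ℂ}
    (hw : 0 < w.im) :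
    sumU₂ ℓ h (-1 / w) = (-1) ^ n * sqrtNegI w ^ (r + 4 * n) * sumU₂ ℓ h w := by
  have hw0 : w ≠ 0 := by rintro rfl; simp at hw
  have hℓ0 : (ℓ : ℂ) ≠ 0 := by exact_mod_cast (Fact.out : ℓ.Prime).ne_zero
  have hu : IsUnit (-576 : ZMod (ℓ ^ 2)) := by
    have h576 : IsCoprime (((ℓ ^ 2 : ℕ) : ℤ)) (-576) := by
      have := (isCoprime_576_of_twelve (isCoprime_prime_twelve hℓ)).neg_right
      push_cast
      exact this.pow_left
    rw [← ZMod.coe_int_isUnit_iff_isCoprime] at h576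
    exact_mod_cast h576
  let e : (ZMod (ℓ ^ 2))ˣ ≃ (ZMod (ℓ ^ 2))ˣ := (Equiv.inv _).trans (Equiv.mulLeft hu.unit⁻¹)
  have he (b : (ZMod (ℓ ^ 2))ˣ) : (576 * (((b : ZMod (ℓ ^ 2)).val : ZMod (ℓ ^ 2))) *
      (((e b : ZMod (ℓ ^ 2)).val : ZMod (ℓ ^ 2))) + 1 : ZMod (ℓ ^ 2)) = 0 := by
    rw [ZMod.natCast_zmod_val, ZMod.natCast_zmod_val]
    have h1 : hu.unit * b * e b = 1 := by simp [e, mul_assoc, mul_comm, mul_left_comm]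
    have h2 := congrArg (Units.val) h1
    push_cast at h2
    rw [hu.unit_spec] at h2
    linear_combination -h2
  have key (b : (ZMod (ℓ ^ 2))ˣ) : h ((-1 / w + 24 * ((b : ZMod (ℓ ^ 2)).val : ℂ)) / ℓ ^ 2) =
      (-1) ^ n * sqrtNegI w ^ (r + 4 * n) *
        h ((w + 24 * ((e b : ZMod (ℓ ^ 2)).val : ℂ)) / ℓ ^ 2) := by
    obtain ⟨B, hB⟩ := exists_det_eq (he b)
    have hBC : (24 * ((b : ZMod (ℓ ^ 2)).val : ℂ) * (24 * (-((e b : ZMod (ℓ ^ 2)).val : ℂ))) -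
      B * (ℓ ^ 2 : ℕ) : ℂ) = 1 := by exact_mod_cast hB
    push_cast at hBC
    have him : 0 < ((w + 24 * ((e b : ZMod (ℓ ^ 2)).val : ℂ)) / ℓ ^ 2).im := by
      simpa only [Int.cast_natCast] using im_add_div_sq (ℓ := ℓ) hw ((e b : ZMod (ℓ ^ 2)).val : ℤ)
    have hG := hh.gaussSum (ℓ ^ 2) _ B _ hB _ him
    have hunit : IsUnit ((((b : ZMod (ℓ ^ 2)).val : ℤ) : ZMod (ℓ ^ 2))) := by
      rw [Int.cast_natCast, ZMod.natCast_zmod_val]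
      exact b.isUnit
    rw [quadGaussSum_prime_sq (by omega) hunit] at hG
    have hχ : (chi12' ((ℓ ^ 2 : ℕ) : ℤ) : ℂ) = 1 := by
      have h1 := chi12'_sq (isCoprime_prime_twelve hℓ)
      have h2 : chi12' ((ℓ ^ 2 : ℕ) : ℤ) = chi12' ℓ ^ 2 := by
        simp [chi12']
      rw [h2, h1, Int.cast_one]
    have hsqrt : ((√((ℓ ^ 2 : ℕ) : ℝ) : ℝ) : ℂ) = ℓ := by
      rw [Nat.cast_pow, Real.sqrt_sq (Nat.cast_nonneg ℓ), Complex.ofReal_natCast]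
    rw [hχ, hsqrt, div_self hℓ0, one_pow, one_mul, mul_one] at hG
    push_cast at hG
    have e1 : (ℓ : ℂ) ^ 2 * ((w + 24 * ((e b : ZMod (ℓ ^ 2)).val : ℂ)) / ℓ ^ 2) +
        24 * (-((e b : ZMod (ℓ ^ 2)).val : ℂ)) = w := by
      field_simp
      ring
    have e2 : (24 * ((b : ZMod (ℓ ^ 2)).val : ℂ) *
        ((w + 24 * ((e b : ZMod (ℓ ^ 2)).val : ℂ)) / ℓ ^ 2) + B) / w =
        (-1 / w + 24 * ((b : ZMod (ℓ ^ 2)).val : ℂ)) / ℓ ^ 2 := by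
      field_simp
      linear_combination -hBC
    rw [e1, e2] at hG
    exact hG
  rw [sumU₂, Finset.sum_congr rfl fun b _ => key b, ← Finset.mul_sum, sumU₂]
  congr 1
  exact Equiv.sum_comp e (fun b => h ((w + 24 * ((b : ZMod (ℓ ^ 2)).val : ℂ)) / ℓ ^ 2))

/-- The Hecke operator commutes with the inversion. -/
theorem EtaTransforms.heckeSum_neg_inv (hh : EtaTransforms r n h) (hr : Odd r) (hℓ : 3 < ℓ)
    (hk : 2 * k + 1 = r + 4 * n) {w : ℂ} (hw : 0 < w.im) :
    heckeSum k ℓ h (-1 / w) = (-1) ^ n * sqrtNegI w ^ (r + 4 * n) * heckeSum k ℓ h w := by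
  have hw0 : w ≠ 0 := by rintro rfl; simp at hw
  have hℓ0 : (ℓ : ℂ) ≠ 0 := by exact_mod_cast (Fact.out : ℓ.Prime).ne_zero
  have hℓr : (0 : ℝ) < ℓ := by exact_mod_cast (Fact.out : ℓ.Prime).pos
  have h0 : h (-1 / w / ℓ ^ 2) =
      (-1) ^ n * sqrtNegI w ^ (r + 4 * n) * (ℓ : ℂ) ^ (r + 4 * n) * h (ℓ ^ 2 * w) := by
    have h1 := hh.neg_inv (im_sq_mul (ℓ := ℓ) hw)
    have h2 := sqrtNegI_ofReal_mul (a := (ℓ : ℝ) ^ 2) (by positivity) hw0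
    rw [Real.sqrt_sq hℓr.le] at h2
    push_cast at h2
    rw [h2] at h1
    rw [show -1 / w / (ℓ : ℂ) ^ 2 = -1 / (ℓ ^ 2 * w) by field_simp, h1]
    ring
  have h3 : h (ℓ ^ 2 * (-1 / w)) =
      (-1) ^ n * sqrtNegI w ^ (r + 4 * n) * ((ℓ : ℂ) ^ (r + 4 * n))⁻¹ * h (w / ℓ ^ 2) := by
    have him : 0 < (w / (ℓ : ℂ) ^ 2).im := by
      have := im_add_div_sq (ℓ := ℓ) hw 0
      simpa using this
    have h1 := hh.neg_inv him
    have h2 := sqrtNegI_ofReal_mul (a := ((ℓ : ℝ) ^ 2)⁻¹) (by positivity) hw0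
    rw [Real.sqrt_inv, Real.sqrt_sq hℓr.le] at h2
    push_cast at h2
    rw [div_eq_inv_mul w, h2] at h1
    rw [div_eq_inv_mul w, show (ℓ : ℂ) ^ 2 * (-1 / w) = -1 / (((ℓ : ℂ) ^ 2)⁻¹ * w) by
      field_simp, h1]
    ring
  have hg2 := legendreGaussSum_sq (ℓ := ℓ) (by omega)
  have hleg : legendreChar ℓ (-1) ^ 2 = 1 := by rw [legendreChar_sq_eq, if_neg (by simp)]
  have hχ : (chi12' ℓ : ℂ) ^ 2 = 1 := by exact_mod_cast chi12'_sq (isCoprime_prime_twelve hℓ)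
  have hg : legendreGaussSum ℓ ≠ 0 := by
    intro hz
    rw [hz, zero_pow two_ne_zero, eq_comm, mul_eq_zero] at hg2
    rcases hg2 with hg2 | hg2
    · rw [hg2] at hleg
      simp at hleg
    · exact hℓ0 hg2
  rw [heckeSum, heckeSum, hh.sumU_eq (im_neg_inv_pos hw), hh.sumU_eq hw, h0,
    hh.sumU₁_neg_inv hr hℓ hw, hh.sumU₂_neg_inv hℓ hw, hh.sumV_neg_inv hr hℓ hw, h3]
  have hgp : legendreGaussSum ℓ ^ (r + 4 * n) =
      legendreGaussSum ℓ * (legendreChar ℓ (-1) ^ k * (ℓ : ℂ) ^ k) := by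
    rw [← hk, pow_succ, pow_mul, hg2, mul_pow]
    ring
  have hℓp : (ℓ : ℂ) ^ (r + 4 * n) = (ℓ : ℂ) ^ k * (ℓ : ℂ) ^ k * ℓ := by
    rw [← hk, pow_succ, two_mul, pow_add]
  have hz1 : (ℓ : ℂ) ^ ((k : ℤ) - 1) = (ℓ : ℂ) ^ k / ℓ := by
    rw [zpow_sub_one₀ hℓ0, zpow_natCast, div_eq_mul_inv]
  have hz2 : (ℓ : ℂ) ^ (2 * (k : ℤ) - 1) = (ℓ : ℂ) ^ k * (ℓ : ℂ) ^ k / ℓ := by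
    rw [zpow_sub_one₀ hℓ0, two_mul, zpow_add₀ hℓ0, zpow_natCast, div_eq_mul_inv]
  have hlegk : (legendreChar ℓ (-1) ^ k) ^ 2 = 1 := by rw [← pow_mul, mul_comm, pow_mul, hleg,
    one_pow]
  have hginv : (legendreGaussSum ℓ)⁻¹ = legendreGaussSum ℓ * legendreChar ℓ (-1) / ℓ := by
    field_simp
    rw [hg2]
    linear_combination -(ℓ : ℂ) * hleg
  have hLk : (ℓ : ℂ) ^ k ≠ 0 := pow_ne_zero k hℓ0
  -- From here only scalars remain: `hW` and `hU₀` match b = 0 with the dilation, and `hU₁` matches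
  -- one direction of the exchange with the twist. Both use 2k + 1 = r + 4n.
  rw [hgp, hℓp, hz1, hz2, hginv]
  generalize legendreChar ℓ (-1) ^ k = lamk at *
  generalize (ℓ : ℂ) ^ k = Lk at *
  generalize legendreChar ℓ (-1) = lam at *
  generalize legendreGaussSum ℓ = g at *
  generalize (chi12' ℓ : ℂ) = χ at *
  generalize sumU₁ ℓ h w = U₁
  generalize sumU₂ ℓ h w = U₂
  generalize sumV ℓ h w = V
  generalize h (w / ℓ ^ 2) = U₀
  generalize h (ℓ ^ 2 * w) = W
  generalize sqrtNegI w ^ (r + 4 * n) = s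
  have hW : ((ℓ : ℂ) ^ 2)⁻¹ * (Lk * Lk * ℓ) = Lk * Lk / ℓ := by field_simp
  have hU₀ : Lk * Lk / ℓ * (Lk * Lk * ℓ)⁻¹ = ((ℓ : ℂ) ^ 2)⁻¹ := by field_simp
  have hU₁ : χ * lamk * (Lk / ℓ) * (g * lam / ℓ) * (χ * (g * (lamk * Lk)) * (Lk * Lk * ℓ)⁻¹) =
      ((ℓ : ℂ) ^ 2)⁻¹ := by
    have e : χ * lamk * (Lk / ℓ) * (g * lam / ℓ) * (χ * (g * (lamk * Lk)) * (Lk * Lk * ℓ)⁻¹) =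
        χ ^ 2 * lamk ^ 2 * g ^ 2 * lam / ℓ ^ 3 := by field_simp
    rw [e, hχ, hlegk, hg2]
    field_simp
    linear_combination hleg
  linear_combination (-1) ^ n * s * (U₁ * hU₁ + U₀ * hU₀ + W * hW)

end HeckeInversion

end HalfIntegral

namespace HalfIntegral

open Complex hiding eta
open Filter Topology ModularForm

/-! ### Stability: the quotient by η^r is a level-one modular form -/

section HeckeStable

variable {r m n k ℓ : ℕ}

lemma etaForm_mul24_eq (F : ModularForm 𝒮ℒ (m : ℤ)) (τ : ℍ) :
    etaForm r F (mul24 τ) = etaForm r F (ofComplex (24 * (τ : ℂ))) := by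
  rw [← coe_mul24, ofComplex_apply]

lemma qParam_one_pow (τ : ℍ) (n : ℕ) : Function.Periodic.qParam 1 (τ : ℂ) ^ n =
    cexp (2 * Real.pi * I * n * (24 * (τ : ℂ) / 24)) := by
  rw [Function.Periodic.qParam, ← Complex.exp_nat_mul]
  congr 1
  push_cast
  ring

lemma periodic_etaForm_mul24 (F : ModularForm 𝒮ℒ (m : ℤ)) :
    Function.Periodic ((fun τ => etaForm r F (mul24 τ)) ∘ ofComplex) ((1 : ℝ) : ℂ) := by
  intro z
  simp only [Function.comp_apply]
  by_cases hz : 0 < z.im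
  · have hz1 : 0 < (z + ((1 : ℝ) : ℂ)).im := by simpa using hz
    have hz24 : 0 < (24 * z).im := by simpa using hz
    rw [etaForm_mul24_eq, etaForm_mul24_eq, ofComplex_apply_of_im_pos hz,
      ofComplex_apply_of_im_pos hz1]
    have := etaForm_ofComplex_add_intCast (r := r) F hz24 24
    rw [show 2 * Real.pi * I * ((24 : ℤ) : ℂ) / 24 = 2 * Real.pi * I by push_cast; ring,
      Complex.exp_two_pi_mul_I, one_pow, one_mul] at this
    rw [UpperHalfPlane.coe_mk, UpperHalfPlane.coe_mk, ← this]
    congr 2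
    push_cast
    ring
  · have hz1 : ¬ 0 < (z + ((1 : ℝ) : ℂ)).im := by simpa using hz
    rw [ofComplex_apply_of_im_nonpos (not_lt.mp hz), ofComplex_apply_of_im_nonpos (not_lt.mp hz1)]

lemma isZeroAtImInfty_etaForm_mul24 (hr : 1 ≤ r) (F : ModularForm 𝒮ℒ (m : ℤ)) :
    IsZeroAtImInfty (fun τ => etaForm r F (mul24 τ)) := by
  refine (isZeroAtImInfty_etaForm hr F).comp ?_
  rw [atImInfty, tendsto_comap_iff]
  have : (UpperHalfPlane.im ∘ mul24) = fun τ : ℍ => 24 * τ.im := by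
    funext τ
    rw [Function.comp_apply, ← coe_im, coe_mul24]
    simp
  rw [this]
  exact tendsto_comap.const_mul_atTop (by norm_num)

lemma isBoundedAtImInfty_of_isZero {f : ℍ → ℂ} (hf : IsZeroAtImInfty f) : IsBoundedAtImInfty f :=
  Filter.ZeroAtFilter.boundedAtFilter hf

lemma hasExpansion24_etaForm (hr : 1 ≤ r) (F : ModularForm 𝒮ℒ (m : ℤ)) :
    HasExpansion24 (qCoeff fun τ => etaForm r F (mul24 τ))
      (fun w => etaForm r F (ofComplex w)) := by
  intro w hw
  have hw' : 0 < (w / 24).im := by simpa using hw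
  have h := UpperHalfPlane.hasSum_qExpansion one_pos (periodic_etaForm_mul24 F)
    (mdifferentiable_comp_mul24 (mdifferentiable_etaForm F))
    (isBoundedAtImInfty_of_isZero (isZeroAtImInfty_etaForm_mul24 hr F)) ⟨w / 24, hw'⟩
  rw [etaForm_mul24_eq, UpperHalfPlane.coe_mk, mul_div_cancel₀ w (by norm_num : (24 : ℂ) ≠ 0)] at h
  refine h.congr_fun fun n => ?_
  have := qParam_one_pow ⟨w / 24, hw'⟩ n
  rw [UpperHalfPlane.coe_mk] at this
  rw [this, qCoeff, smul_eq_mul, mul_div_cancel_left₀ _ (by norm_num : (24 : ℂ) ≠ 0)]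

/-- Uniqueness of the power series of the cusp function at q = 0. -/
lemma qCoeff_eq_of_hasSum {g : ℍ → ℂ} {c : ℕ → ℂ} (hg : AnalyticAt ℂ (cuspFunction 1 g) 0)
    (h : ∀ τ : ℍ, HasSum (fun n => c n • Function.Periodic.qParam 1 (τ : ℂ) ^ n) (g τ)) (n : ℕ) :
    c n = qCoeff g n := by
  have h1 := (UpperHalfPlane.hasFPowerSeriesOnBall_cuspFunction one_pos hg h).hasFPowerSeriesAt
  have h2 := congrArg (FormalMultilinearSeries.coeff · n)
    (h1.eq_formalMultilinearSeries hg.hasFPowerSeriesAt)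
  simp only [FormalMultilinearSeries.coeff_ofScalars] at h2
  rw [qCoeff, qExpansion_coeff, h2, div_eq_inv_mul]

lemma exp_div_24_eq_one_iff (j : ℤ) : cexp (2 * Real.pi * I * (j / 24)) = 1 ↔ (24 : ℤ) ∣ j := by
  have h0 : (2 * Real.pi * I : ℂ) ≠ 0 := Complex.two_pi_I_ne_zero
  rw [Complex.exp_eq_one_iff]
  constructor
  · rintro ⟨n, hn⟩
    refine ⟨n, ?_⟩
    rw [mul_comm (n : ℂ)] at hn
    have := mul_left_cancel₀ h0 hn
    rw [div_eq_iff (by norm_num)] at this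
    rw [mul_comm]
    exact_mod_cast this
  · rintro ⟨n, rfl⟩
    refine ⟨n, ?_⟩
    push_cast
    ring

/-- Under w ↦ w + 1 the form is multiplied by exp(2πi r/24) and the n-th term by exp(2πi n/24);
uniqueness of the expansion compares the two. -/
lemma modEq_of_qCoeff_ne_zero (hr : 1 ≤ r) (F : ModularForm 𝒮ℒ (m : ℤ)) {n : ℕ}
    (hn : qCoeff (fun τ => etaForm r F (mul24 τ)) n ≠ 0) : (24 : ℤ) ∣ n - r := by
  set g : ℍ → ℂ := fun τ => etaForm r F (mul24 τ) with hg
  have hsum (τ : ℍ) : HasSum (fun n : ℕ => (qCoeff g n * cexp (2 * Real.pi * I *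
      (((n : ℤ) - r : ℤ) / 24))) • Function.Periodic.qParam 1 (τ : ℂ) ^ n) (g τ) := by
    have hτ : 0 < (24 * (τ : ℂ)).im := by simpa using τ.im_pos
    have hτ1 : 0 < (24 * (τ : ℂ) + ((1 : ℤ) : ℂ)).im := by simpa using τ.im_pos
    have h1 := hasExpansion24_etaForm hr F _ hτ1
    beta_reduce at h1
    rw [etaForm_ofComplex_add_intCast F hτ, ← etaForm_mul24_eq] at h1
    have h2 := h1.mul_left (cexp (2 * Real.pi * I * ((1 : ℤ) : ℂ) / 24) ^ r)⁻¹
    rw [inv_mul_cancel_left₀ (pow_ne_zero _ (Complex.exp_ne_zero _))] at h2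
    refine h2.congr_fun fun n => ?_
    rw [smul_eq_mul, qParam_one_pow, ← Complex.exp_nat_mul, ← Complex.exp_neg,
      mul_left_comm, ← Complex.exp_add, mul_assoc, ← Complex.exp_add]
    congr 2
    push_cast
    ring
  have han : AnalyticAt ℂ (cuspFunction 1 g) 0 :=
    analyticAt_cuspFunction_zero one_pos (periodic_etaForm_mul24 F)
      (mdifferentiable_comp_mul24 (mdifferentiable_etaForm F))
      (isBoundedAtImInfty_of_isZero (isZeroAtImInfty_etaForm_mul24 hr F))
  have huniq := qCoeff_eq_of_hasSum han hsum n
  exact (exp_div_24_eq_one_iff _).mp (mul_left_cancel₀ hn (huniq.trans (mul_one _).symm))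

variable [Fact ℓ.Prime]

lemma sq_dvd_sub_one (hℓ : 3 < ℓ) : (24 : ℤ) ∣ (ℓ : ℤ) ^ 2 - 1 := by
  have h1 := emod_twelve_of_isCoprime (isCoprime_prime_twelve hℓ)
  obtain ⟨q, hq⟩ : ∃ q : ℤ, (ℓ : ℤ) = 12 * q + (ℓ : ℤ) % 12 := ⟨ℓ / 12, by omega⟩
  rcases h1 with h | h | h | h <;> rw [h] at hq <;> rw [hq]
  · exact ⟨6 * q ^ 2 + q, by ring⟩
  · exact ⟨6 * q ^ 2 + 5 * q + 1, by ring⟩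
  · exact ⟨6 * q ^ 2 + 7 * q + 2, by ring⟩
  · exact ⟨6 * q ^ 2 + 11 * q + 5, by ring⟩

/-- Since ℓ² ≡ 1 (mod 24), the indices ℓ²n, n and n/ℓ² all lie in the same class modulo 24. -/
lemma modEq_of_heckeCoeff_ne_zero (hr : 1 ≤ r) (hℓ : 3 < ℓ) (F : ModularForm 𝒮ℒ (m : ℤ)) {n : ℕ}
    (hn : heckeCoeff k chi12 ℓ (fun τ => etaForm r F (mul24 τ)) n ≠ 0) : (24 : ℤ) ∣ n - r := by
  obtain ⟨t, ht⟩ := sq_dvd_sub_one hℓ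
  by_contra hcon
  apply hn
  have h1 : qCoeff (fun τ => etaForm r F (mul24 τ)) (ℓ ^ 2 * n) = 0 := by
    by_contra h
    obtain ⟨s, hs⟩ := modEq_of_qCoeff_ne_zero hr F h
    push_cast at hs
    exact hcon ⟨s - t * n, by linear_combination hs - n * ht⟩
  have h2 : qCoeff (fun τ => etaForm r F (mul24 τ)) n = 0 := by
    by_contra h
    exact hcon (modEq_of_qCoeff_ne_zero hr F h)
  have h3 : (if ℓ ^ 2 ∣ n then qCoeff (fun τ => etaForm r F (mul24 τ)) (n / ℓ ^ 2) else 0) = 0 := by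
    split_ifs with hd
    · obtain ⟨j, rfl⟩ := hd
      rw [Nat.mul_div_cancel_left _ (pow_pos (Fact.out : ℓ.Prime).pos 2)]
      by_contra h
      obtain ⟨s, hs⟩ := modEq_of_qCoeff_ne_zero hr F h
      push_cast at hcon
      exact hcon ⟨s + t * j, by linear_combination hs + j * ht⟩
    · rfl
  rw [heckeCoeff, h1, h2, h3]
  simp

lemma hasSum_heckeCoeff_etaForm (k : ℕ) (hr : 1 ≤ r) (hℓ : 3 < ℓ) (F : ModularForm 𝒮ℒ (m : ℤ))
    {w : ℂ} (hw : 0 < w.im) :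
    HasSum (fun n : ℕ => heckeCoeff k chi12 ℓ (fun τ => etaForm r F (mul24 τ)) n *
      cexp (2 * Real.pi * I * n * (w / 24)))
      (heckeSum k ℓ (fun w => etaForm r F (ofComplex w)) w) :=
  hasSum_heckeCoeff k hℓ (hasExpansion24_etaForm hr F) hw

lemma hasSum_hecke (k : ℕ) (hr : 1 ≤ r) (hℓ : 3 < ℓ) (F : ModularForm 𝒮ℒ (m : ℤ)) (τ : ℍ) :
    HasSum (fun n : ℕ => heckeCoeff k chi12 ℓ (fun τ => etaForm r F (mul24 τ)) n *
      cexp (2 * Real.pi * I * (τ : ℂ)) ^ n)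
      (heckeSum k ℓ (fun w => etaForm r F (ofComplex w)) (24 * τ)) := by
  have hτ : 0 < (24 * (τ : ℂ)).im := by simpa using τ.im_pos
  refine (hasSum_heckeCoeff_etaForm k hr hℓ F hτ).congr_fun fun n => ?_
  rw [← Complex.exp_nat_mul]
  congr 2
  ring

lemma heckeSum_add_one (k : ℕ) (hr : 1 ≤ r) (hℓ : 3 < ℓ) (F : ModularForm 𝒮ℒ (m : ℤ)) {w : ℂ}
    (hw : 0 < w.im) :
    heckeSum k ℓ (fun w => etaForm r F (ofComplex w)) (w + 1) =
      cexp (2 * Real.pi * I / 24) ^ r * heckeSum k ℓ (fun w => etaForm r F (ofComplex w)) w := by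
  have h1 := hasSum_heckeCoeff_etaForm k hr hℓ F (w := w + 1) (by simpa using hw)
  have h2 := (hasSum_heckeCoeff_etaForm k hr hℓ F hw).mul_left (cexp (2 * Real.pi * I / 24) ^ r)
  refine h1.unique (h2.congr_fun fun n => ?_)
  by_cases hn : heckeCoeff k chi12 ℓ (fun τ => etaForm r F (mul24 τ)) n = 0
  · rw [hn]
    simp
  · have h3 := (exp_div_24_eq_one_iff _).mpr (modEq_of_heckeCoeff_ne_zero hr hℓ F hn)
    rw [mul_left_comm, ← Complex.exp_nat_mul, ← Complex.exp_add]
    rw [show 2 * Real.pi * I * n * ((w + 1) / 24) = r * (2 * Real.pi * I / 24) +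
      2 * Real.pi * I * n * (w / 24) + 2 * Real.pi * I * (((n : ℤ) - r : ℤ) / 24) by
        push_cast; ring, Complex.exp_add, h3, mul_one]

/-- The quotient of `heckeSum` by `η^r`. -/
noncomputable def heckeQuotient (r k ℓ : ℕ) [Fact ℓ.Prime] (F : ModularForm 𝒮ℒ (m : ℤ))
    (w : ℍ) : ℂ :=
  heckeSum k ℓ (fun w => etaForm r F (ofComplex w)) w / eta (w : ℂ) ^ r

lemma isBoundedAtImInfty_heckeQuotient (k : ℕ) (hr : 1 ≤ r) (hr' : r ≤ 23) (hℓ : 3 < ℓ)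
    (F : ModularForm 𝒮ℒ (m : ℤ)) : IsBoundedAtImInfty (heckeQuotient r k ℓ F) := by
  set c := heckeCoeff k chi12 ℓ (fun τ => etaForm r F (mul24 τ))
  have hB : IsBoundedAtImInfty fun w : ℍ => cexp (-(2 * Real.pi * I * r * (w / 24))) *
      heckeSum k ℓ (fun w => etaForm r F (ofComplex w)) w := by
    refine isBoundedAtImInfty_of_hasSum_qExpansion (h := 24) (c := fun n => c (n + r))
      (by norm_num) fun w => ?_
    have h1 := (hasSum_heckeCoeff_etaForm k hr hℓ F w.im_pos).mul_left
      (cexp (-(2 * Real.pi * I * r * (w / 24))))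
    have h2 := ((add_left_injective r).hasSum_iff (fun n hn => ?_)).mpr h1
    · refine h2.congr_fun fun n => ?_
      rw [Function.comp_apply, mul_left_comm, ← Complex.exp_add, smul_eq_mul,
        Function.Periodic.qParam, ← Complex.exp_nat_mul]
      congr 2
      push_cast
      ring
    · have : c n = 0 := by
        by_contra h
        have hd := modEq_of_heckeCoeff_ne_zero hr hℓ F h
        -- A natural number congruent to r modulo 24 is at least r, because r ≤ 23.
        exact hn ⟨n - r, by simp only; omega⟩
      simp only [c] at this
      rw [this]
      simp
  -- The lower bound for η near infinity is the 24th root of that for Δ.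
  have hE : (fun w : ℍ => cexp (2 * Real.pi * I * r * (w / 24))) =O[atImInfty]
      fun w : ℍ => eta (w : ℂ) ^ r := by
    have h1 : (fun w : ℍ => cexp (2 * Real.pi * I * (w / 24))) =O[atImInfty]
        fun w : ℍ => eta (w : ℂ) := by
      obtain ⟨C, hC⟩ := exp_isBigO_discriminant.bound
      refine Asymptotics.IsBigO.of_bound (max C 1) ?_
      filter_upwards [hC] with w hw
      have e : ‖cexp (2 * Real.pi * I * (w / 24))‖ ^ 24 = Real.exp (-2 * Real.pi * w.im) := by
        rw [← norm_pow, ← Complex.exp_nat_mul, Complex.norm_exp]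
        congr 1
        push_cast
        rw [show 24 * (2 * Real.pi * I * ((w : ℂ) / 24)) = ((2 * Real.pi : ℝ) : ℂ) * (I * w) by
          push_cast; ring, Complex.re_ofReal_mul, Complex.I_mul_re]
        simp
      rw [discriminant, norm_pow, Real.norm_of_nonneg (Real.exp_pos _).le, ← e] at hw
      refine le_of_pow_le_pow_left₀ (n := 24) (by norm_num) (by positivity) (hw.trans ?_)
      rw [mul_pow]
      gcongr
      exact (le_max_left C 1).trans (le_self_pow₀ (le_max_right C 1) (by norm_num))
    have h2 := h1.pow r
    refine h2.congr_left fun w => ?_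
    rw [← Complex.exp_nat_mul]
    congr 1
    ring
  have h1 := hE.mul (hB.trans (Asymptotics.isBigO_const_const (1 : ℝ) (one_ne_zero' ℂ) atImInfty))
  have h2 := h1.mul (Asymptotics.isBigO_refl (fun w : ℍ => (eta (w : ℂ) ^ r)⁻¹) atImInfty)
  refine (h2.congr (fun w => ?_) fun w => ?_).trans
    (Asymptotics.isBigO_const_const (1 : ℂ) (one_ne_zero' ℝ) atImInfty)
  · rw [heckeQuotient, ← mul_assoc, ← Complex.exp_add, add_neg_cancel, Complex.exp_zero, one_mul,
      div_eq_mul_inv]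
  · rw [mul_one]
    exact mul_inv_cancel₀ (pow_ne_zero r (eta_ne_zero w.im_pos))

lemma mdifferentiable_heckeQuotient (r k : ℕ) (F : ModularForm 𝒮ℒ (m : ℤ)) :
    MDifferentiable 𝓘(ℂ) 𝓘(ℂ) (heckeQuotient r k ℓ F) := by
  have hh : DifferentiableOn ℂ (fun w => etaForm r F (ofComplex w)) {z | 0 < z.im} :=
    UpperHalfPlane.mdifferentiable_iff.mp (mdifferentiable_etaForm (r := r) F)
  rw [UpperHalfPlane.mdifferentiable_iff]
  have h1 : DifferentiableOn ℂ (sumU ℓ fun w => etaForm r F (ofComplex w)) {z | 0 < z.im} := by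
    refine DifferentiableOn.fun_sum fun b _ => hh.comp (by fun_prop) fun z hz => ?_
    simpa only [Int.cast_natCast, Set.mem_ofPred_eq] using im_add_div_sq (ℓ := ℓ) hz (b.val : ℤ)
  have h2 : DifferentiableOn ℂ (sumV ℓ fun w => etaForm r F (ofComplex w)) {z | 0 < z.im} := by
    refine DifferentiableOn.fun_sum fun u _ => DifferentiableOn.const_mul
      (hh.comp (f := fun z => z + 24 * (u.val : ℂ) / ℓ) (by fun_prop) fun z hz => ?_) _
    simpa only [Int.cast_natCast, Set.mem_ofPred_eq] using im_add_div (ℓ := ℓ) hz (u.val : ℤ)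
  have h3 : DifferentiableOn ℂ (fun w => etaForm r F (ofComplex (ℓ ^ 2 * w))) {z | 0 < z.im} :=
    hh.comp (f := fun z => (ℓ : ℂ) ^ 2 * z) (by fun_prop) fun z hz => im_sq_mul hz
  have h4 : DifferentiableOn ℂ (fun w => eta w ^ r) {z | 0 < z.im} := fun z hz =>
    ((differentiableAt_eta_of_mem_upperHalfPlaneSet hz).pow r).differentiableWithinAt
  have h5 := ((((h1.const_mul ((ℓ : ℂ) ^ 2)⁻¹).add
    (h2.const_mul (chi12' ℓ * legendreChar ℓ (-1) ^ k *
    (ℓ : ℂ) ^ ((k : ℤ) - 1) * (legendreGaussSum ℓ)⁻¹))).add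
    (h3.const_mul ((ℓ : ℂ) ^ (2 * (k : ℤ) - 1)))).div h4 fun z hz => pow_ne_zero r (eta_ne_zero hz))
  refine h5.congr fun z hz => ?_
  rw [Function.comp_apply, heckeQuotient, ofComplex_apply_of_im_pos hz]
  rfl

lemma heckeQuotient_slash_T (k : ℕ) (hr : 1 ≤ r) (hℓ : 3 < ℓ) (F : ModularForm 𝒮ℒ (m : ℤ)) :
    heckeQuotient r k ℓ F ∣[(m : ℤ)] ModularGroup.T = heckeQuotient r k ℓ F := by
  funext τ
  have h := eta_add_intCast (τ : ℂ) 1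
  rw [Int.cast_one, mul_one] at h
  rw [SL_slash_apply, modular_T_smul]
  have hv : (((1 : ℝ) +ᵥ τ : ℍ) : ℂ) = τ + 1 := by
    rw [UpperHalfPlane.coe_vadd]
    push_cast
    ring
  rw [heckeQuotient, heckeQuotient, hv, heckeSum_add_one k hr hℓ F τ.im_pos, h, mul_pow,
    mul_div_mul_left _ _ (pow_ne_zero _ (Complex.exp_ne_zero _)), ModularGroup.denom_apply]
  simp [ModularGroup.T]

/-- The factor `sqrtNegI ^ r` cancels against η^r, and what remains, (-1)^n `sqrtNegI` ^ (4n), is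
the weight 2n factor. -/
lemma heckeQuotient_slash_S (hr : Odd r) (hℓ : 3 < ℓ) (hk : 2 * k + 1 = r + 4 * n)
    (F : ModularForm 𝒮ℒ ((n + n : ℕ) : ℤ)) :
    heckeQuotient r k ℓ F ∣[((n + n : ℕ) : ℤ)] ModularGroup.S = heckeQuotient r k ℓ F := by
  funext τ
  rw [SL_slash_apply, ModularGroup.denom_S, modular_S_smul, heckeQuotient, heckeQuotient,
    UpperHalfPlane.coe_mk, show (-(τ : ℂ))⁻¹ = -1 / τ by rw [neg_div, one_div, inv_neg],
    (etaTransforms_etaForm hr F).heckeSum_neg_inv hr hℓ hk τ.im_pos, eta_neg_inv τ.im_pos,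
    mul_pow, pow_add, sqrtNegI_pow_eq, zpow_neg, zpow_natCast]
  have h0 := τ.ne_zero
  have hs := pow_ne_zero r (sqrtNegI_ne_zero τ.ne_zero)
  have he := pow_ne_zero r (eta_ne_zero τ.im_pos)
  have hone : ((-1 : ℂ)) ^ n * (-1) ^ n = 1 := by rw [← mul_pow]; simp
  have hτ : (τ : ℂ) ^ (n + n) = τ ^ (2 * n) := by rw [two_mul]
  rw [hτ]
  field_simp
  linear_combination heckeSum k ℓ (fun w => etaForm r F (ofComplex w)) τ * hone

/-- The quotient of the image under the Hecke operator by `η^r`, as a modular form. -/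
noncomputable def heckeForm (hr : 1 ≤ r) (hr' : r ≤ 23) (hodd : Odd r) (hℓ : 3 < ℓ)
    (hk : 2 * k + 1 = r + 4 * n) (F : ModularForm 𝒮ℒ ((n + n : ℕ) : ℤ)) :
    ModularForm 𝒮ℒ ((n + n : ℕ) : ℤ) where
  toFun := heckeQuotient r k ℓ F
  slash_action_eq' A hA := by
    obtain ⟨A, rfl⟩ := hA
    exact SlashInvariantForm.slash_action_generators_SL2Z (heckeQuotient_slash_S hodd hℓ hk F)
      (heckeQuotient_slash_T k hr hℓ F) A
  holo' := mdifferentiable_heckeQuotient r k F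
  bdd_at_cusps' hc := by
    rw [OnePoint.isBoundedAt_iff_forall_SL2Z hc]
    intro γ _
    rw [SlashInvariantForm.slash_action_generators_SL2Z (heckeQuotient_slash_S hodd hℓ hk F)
      (heckeQuotient_slash_T k hr hℓ F)]
    exact isBoundedAtImInfty_heckeQuotient k hr hr' hℓ F

lemma hecke_mem_etaSpace (hr : 1 ≤ r) (hr' : r ≤ 23) (hodd : Odd r) (hm : Even m) (hℓ : 3 < ℓ)
    (hk : 2 * k + 1 = r + 2 * m) {g : ℍ → ℂ} (hg : g ∈ etaSpace r m) :
    hecke k chi12 ℓ g ∈ etaSpace r m := by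
  obtain ⟨n, rfl⟩ := hm
  obtain ⟨F, hF⟩ := hg
  obtain rfl : g = fun τ => etaForm r F (mul24 τ) := funext hF
  refine ⟨heckeForm hr hr' hodd hℓ (k := k) (ℓ := ℓ) (by omega) F, fun τ => ?_⟩
  have h0 := pow_ne_zero r (eta_ne_zero (mul24 τ).im_pos)
  change _ = eta (mul24 τ : ℂ) ^ r * heckeQuotient r k ℓ F (mul24 τ)
  rw [heckeQuotient, mul_div_cancel₀ _ h0, hecke, (hasSum_hecke k hr hℓ F τ).tsum_eq, coe_mul24]

lemma summable_hecke (hr : 1 ≤ r) (hℓ : 3 < ℓ) {g : ℍ → ℂ} (hg : g ∈ etaSpace r m) (τ : ℍ) :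
    Summable fun n : ℕ => heckeCoeff k chi12 ℓ g n * cexp (2 * Real.pi * I * (τ : ℂ)) ^ n := by
  obtain ⟨F, hF⟩ := hg
  obtain rfl : g = fun τ => etaForm r F (mul24 τ) := funext hF
  exact (hasSum_hecke k hr hℓ F τ).summable

end HeckeStable

end HalfIntegral

/-- Here `k + 1/2 = r/2 + m`. The last conjunct says that the series which defines `g ∣ T(ℓ²)`
converges on the upper half-plane. -/
theorem proposition3p1 (r m k ℓ : ℕ) [Fact ℓ.Prime] (hr₁ : 1 ≤ r) (hr₂ : r ≤ 23)
    (hr₃ : Nat.Coprime r 6) (hm : Even m) (hℓ : 3 < ℓ) (hk : 2 * k + 1 = r + 2 * m) :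
    HalfIntegral.etaSpace r m ≤ HalfIntegral.cuspForms k 576 HalfIntegral.chi12 ∧
    (∀ g ∈ HalfIntegral.etaSpace r m,
      HalfIntegral.hecke k HalfIntegral.chi12 ℓ g ∈ HalfIntegral.etaSpace r m) ∧
    (∀ g ∈ HalfIntegral.etaSpace r m, ∀ τ : UpperHalfPlane,
      Summable fun n : ℕ => HalfIntegral.heckeCoeff k HalfIntegral.chi12 ℓ g n *
        Complex.exp (2 * Real.pi * Complex.I * (τ : ℂ)) ^ n) := by
  have hodd : Odd r := (Nat.Coprime.coprime_dvd_right (by norm_num : 2 ∣ 6) hr₃).odd_of_right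
  exact ⟨HalfIntegral.etaSpace_le_cuspForms hr₁ hodd hm hk,
    fun g hg => HalfIntegral.hecke_mem_etaSpace hr₁ hr₂ hodd hm hℓ hk hg,
    fun g hg τ => HalfIntegral.summable_hecke hr₁ hℓ hg τ⟩
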